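/- Conventions. $\mathbb E$ denotes a uniform average over a finite set, $\log$ is the natural logarithm, and $S$ ranges over the set $\binom{[n]}{m}$ of $m$-element subsets of $[n]$; for $x\in\{0,1\}^n$ and $S=\{i_1<\dots<i_m\}$ put $x_S=(x_{i_1},\dots,x_{i_m})$. The degree $\deg g$ of $g\colon\{0,1\}^m\to\mathbb R$ is its degree as a multilinear polynomial. A degree-$d$ pseudo-density is a function $D\colon\{0,1\}^m\to\mathbb R$ with $\mathbb E_x D(x)=1$ and $\mathbb E_x D(x)g(x)^2\ge 0$ for every $g\colon\{0,1\}^m\to\mathbb R$ with $\deg g\le d/2$; put $\|D\|_\infty=\max_x|D(x)|$. For a nonnegative matrix $N\colon\binom{[n]}{m}\times\{0,1\}^n\to\mathbb R_{+}$ put $\|N\|_\infty=\max_{S,x}N(S,x)$ and $\|N\|_1=\mathbb E_{S,x}N(S,x)$, and let $\mathrm{rk}_{\mathsf{psd}}(N)$ be the smallest $r$ for which there are real symmetric positive semidefinite $r\times r$ matrices $A_S,B_x$ with $N(S,x)=\mathrm{Tr}(A_SB_x)$ for all $S,x$. Finally, put $L_D(N)=\mathbb E_S\,\mathbb E_x\,D(x_S)N(S,x)$.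 Theorem. There is a universal constant $C>0$ such that the following holds. For all integers $m,d\ge 1$, every $\varepsilon\in(0,1]$ and every degree-$d$ pseudo-density $D\colon\{0,1\}^m\to\mathbb R$, the number $$\alpha=\left(\frac{C\varepsilon}{d\,m^2\,\|D\|_\infty}\right)^{d/2}\left(\frac{\varepsilon}{\|D\|_\infty}\right)^{3}$$ is positive, and whenever $n\ge 2m$ and a nonnegative matrix $N\colon\binom{[n]}{m}\times\{0,1\}^n\to\mathbb R_{+}$ satisfies $$\|N\|_\infty\le 1\qquad\text{and}\qquad \frac{\mathrm{rk}_{\mathsf{psd}}(N)^2}{\|N\|_1}\le\alpha\left(\frac{n}{\log n}\right)^{d/2}$$ (the quotient being read as $0$ if $N=0$), we have $L_D(N)\ge-\varepsilon$. -/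

import Mathlib

open scoped BigOperators

noncomputable section

/-- The discrete cube `{0,1}^n`. -/
abbrev Cube (n : ℕ) : Type := Fin n → Bool

/-- The subsets `S ⊆ [n]` with `|S| = m`. -/
abbrev SubsetOfCard (n m : ℕ) : Type := {S : Finset (Fin n) // S.card = m}

/-- The identification `b ↦ 2 b - 1` of `{0,1}` with `{-1,1}`. -/
def boolSign (b : Bool) : ℝ := if b then 1 else -1

/-- The Fourier character `χ_A(x) = ∏_{i ∈ A} x_i`, read on `{0,1}^n`. -/
def cubeChar {n : ℕ} (A : Finset (Fin n)) (x : Cube n) : ℝ := ∏ i ∈ A, boolSign (x i)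

/-- The Fourier coefficient `f̂(A) = E_x f(x) χ_A(x)`. -/
def fourierCoeffCube {n : ℕ} (f : Cube n → ℝ) (A : Finset (Fin n)) : ℝ :=
  𝔼 x, f x * cubeChar A x

/-- The degree of `f` as a multilinear polynomial: `max {|A| : f̂(A) ≠ 0}`
(with value `0` for `f = 0`). -/
def cubeDegree {n : ℕ} (f : Cube n → ℝ) : ℕ :=
  sSup {k : ℕ | ∃ A : Finset (Fin n), fourierCoeffCube f A ≠ 0 ∧ A.card = k}

/-- The set whose supremum is `cubeDegree f` is bounded, so that supremum is not a junk value. -/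
theorem cubeDegree_bddAbove {n : ℕ} (f : Cube n → ℝ) :
    BddAbove {k : ℕ | ∃ A : Finset (Fin n), fourierCoeffCube f A ≠ 0 ∧ A.card = k} := by
  refine ⟨n, ?_⟩
  rintro k ⟨A, -, rfl⟩
  simpa using A.card_le_univ

/-- `D` is a degree-`d` pseudo-density on `{0,1}^m`. -/
def IsPseudoDensity {m : ℕ} (d : ℕ) (D : Cube m → ℝ) : Prop :=
  𝔼 x, D x = 1 ∧
    ∀ g : Cube m → ℝ, (cubeDegree g : ℝ) ≤ (d : ℝ) / 2 → 0 ≤ 𝔼 x, D x * g x ^ 2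

/-- `M` has a rank-`r` psd factorization `M i j = Tr (A i * B j)`, with real symmetric positive
semidefinite `r × r` matrices `A i` and `B j`. -/
def HasPsdFactorization {ι κ : Type} (M : ι → κ → ℝ) (r : ℕ) : Prop :=
  ∃ (A : ι → Matrix (Fin r) (Fin r) ℝ) (B : κ → Matrix (Fin r) (Fin r) ℝ),
    (∀ i, (A i).PosSemidef) ∧ (∀ j, (B j).PosSemidef) ∧
      ∀ i j, M i j = (A i * B j).trace

/-- The psd rank of `M`: the smallest `r` such that `M` has a rank-`r` psd factorization. -/
def psdRank {ι κ : Type} (M : ι → κ → ℝ) : ℕ := sInf {r : ℕ | HasPsdFactorization M r}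

/-- A nonnegative matrix with finitely many rows has a psd factorization,
so its psd rank is attained. -/
theorem hasPsdFactorization_psdRank {ι κ : Type} [Fintype ι] (M : ι → κ → ℝ)
    (hM : ∀ i j, 0 ≤ M i j) : HasPsdFactorization M (psdRank M) := by
  classical
  refine Nat.sInf_mem (s := {r : ℕ | HasPsdFactorization M r}) ⟨Fintype.card ι, ?_⟩
  let e := Fintype.equivFin ι
  refine ⟨fun i => Matrix.diagonal fun k => if k = e i then 1 else 0,
    fun j => Matrix.diagonal fun k => M (e.symm k) j, ?_, ?_, ?_⟩
  · intro i
    refine Matrix.PosSemidef.diagonal fun k => ?_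
    by_cases h : k = e i <;> simp [h]
  · intro j
    exact Matrix.PosSemidef.diagonal fun k => hM _ _
  · intro i j
    simp [Matrix.diagonal_mul_diagonal, Matrix.trace_diagonal]

/-- The average of the entries of `N`; this is the norm `‖N‖₁` of a nonnegative matrix. -/
def entryAverage {ι κ : Type} [Fintype ι] [Fintype κ] (N : ι → κ → ℝ) : ℝ :=
  𝔼 i, 𝔼 j, N i j

/-- The restriction `x_S = (x_{i_1}, …, x_{i_m})`, where `S = {i_1 < ⋯ < i_m}`. -/
def cubeRestrict {n m : ℕ} (S : SubsetOfCard n m) (x : Cube n) : Cube m :=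
  fun k => x (S.1.orderEmbOfFin S.2 k)

/-- The functional `L_D(N) = E_S E_x D(x_S) N(S,x)`. -/
def separatingFunctional {n m : ℕ} (D : Cube m → ℝ) (N : SubsetOfCard n m → Cube n → ℝ) : ℝ :=
  𝔼 S, 𝔼 x, D (cubeRestrict S x) * N S x

end

/-! ### Fourier analysis on the cube -/

theorem boolSign_mul_self (b : Bool) : boolSign b * boolSign b = 1 := by
  cases b <;> simp [boolSign]

theorem cubeChar_mul {n : ℕ} (A B : Finset (Fin n)) (x : Cube n) :
    cubeChar A x * cubeChar B x = cubeChar (symmDiff A B) x := by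
  have key : ∀ E : Finset (Fin n), cubeChar E x = ∏ i, if i ∈ E then boolSign (x i) else 1 := by
    intro E
    simp [cubeChar, Finset.prod_ite_mem]
  rw [key, key, key, ← Finset.prod_mul_distrib]
  refine Finset.prod_congr rfl fun i _ => ?_
  by_cases hA : i ∈ A <;> by_cases hB : i ∈ B <;>
    simp [Finset.mem_symmDiff, hA, hB, boolSign_mul_self]

theorem sum_cubeChar {n : ℕ} (A : Finset (Fin n)) :
    ∑ x : Cube n, cubeChar A x = if A = ∅ then (2 : ℝ) ^ n else 0 := by
  have key : ∀ x : Cube n, cubeChar A x = ∏ i, if i ∈ A then boolSign (x i) else 1 := by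
    intro x
    simp [cubeChar, Finset.prod_ite_mem]
  simp_rw [key]
  have h := Finset.prod_univ_sum (fun _ : Fin n => (Finset.univ : Finset Bool))
    (fun i b => if i ∈ A then boolSign b else (1 : ℝ))
  rw [Fintype.piFinset_univ] at h
  rw [← h]
  split_ifs with hA
  · subst hA
    simp
  · obtain ⟨i, hi⟩ := Finset.nonempty_iff_ne_empty.mpr hA
    exact Finset.prod_eq_zero (Finset.mem_univ i) (by simp [hi, boolSign])

theorem expect_cubeChar {n : ℕ} (A : Finset (Fin n)) :
    𝔼 x : Cube n, cubeChar A x = if A = ∅ then (1 : ℝ) else 0 := by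
  rw [Fintype.expect_eq_sum_div_card, sum_cubeChar]
  split_ifs <;> simp

theorem expect_cubeChar_mul {n : ℕ} (A B : Finset (Fin n)) :
    𝔼 x : Cube n, cubeChar A x * cubeChar B x = if A = B then (1 : ℝ) else 0 := by
  simp_rw [cubeChar_mul, expect_cubeChar]
  simp [symmDiff_eq_bot, ← Finset.bot_eq_empty]

theorem fourierCoeffCube_sum_cubeChar {n : ℕ} (c : Finset (Fin n) → ℝ) (B : Finset (Fin n)) :
    fourierCoeffCube (fun x => ∑ A, c A * cubeChar A x) B = c B := by
  unfold fourierCoeffCube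
  simp_rw [Finset.sum_mul, mul_assoc]
  rw [Finset.expect_sum_comm]
  simp_rw [← Finset.mul_expect, expect_cubeChar_mul]
  simp

theorem expect_sum_cubeChar_sq {n : ℕ} (c : Finset (Fin n) → ℝ) :
    𝔼 x : Cube n, (∑ A, c A * cubeChar A x) ^ 2 = ∑ A, c A ^ 2 := by
  simp_rw [pow_two (∑ A, c A * cubeChar A _)]
  simp_rw [Finset.mul_sum]
  rw [Finset.expect_sum_comm]
  refine Finset.sum_congr rfl fun B _ => ?_
  have h := fourierCoeffCube_sum_cubeChar c B
  unfold fourierCoeffCube at h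
  calc 𝔼 x : Cube n, (∑ A, c A * cubeChar A x) * (c B * cubeChar B x)
      = c B * 𝔼 x : Cube n, (∑ A, c A * cubeChar A x) * cubeChar B x := by
        rw [Finset.mul_expect]
        exact Finset.expect_congr rfl fun x _ => by ring
    _ = c B ^ 2 := by rw [h]; ring

theorem sum_cubeChar_mul_cubeChar {n : ℕ} (x y : Cube n) :
    ∑ A : Finset (Fin n), cubeChar A x * cubeChar A y = if x = y then (2 : ℝ) ^ n else 0 := by
  have h : ∑ A : Finset (Fin n), cubeChar A x * cubeChar A y
      = ∏ i, (1 + boolSign (x i) * boolSign (y i)) := by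
    rw [Finset.prod_one_add, Finset.powerset_univ]
    exact Finset.sum_congr rfl fun A _ => by simp [cubeChar, Finset.prod_mul_distrib]
  rw [h]
  split_ifs with hxy
  · subst hxy
    simp_rw [boolSign_mul_self]
    norm_num
  · obtain ⟨i, hi⟩ := Function.ne_iff.mp hxy
    refine Finset.prod_eq_zero (Finset.mem_univ i) ?_
    cases hx : x i <;> cases hy : y i <;> simp_all [boolSign]

/-- Fourier inversion. -/
theorem sum_fourierCoeffCube {n : ℕ} (f : Cube n → ℝ) (x : Cube n) :
    ∑ A, fourierCoeffCube f A * cubeChar A x = f x := by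
  unfold fourierCoeffCube
  simp_rw [Finset.expect_mul]
  rw [← Finset.expect_sum_comm]
  simp_rw [mul_assoc, ← Finset.mul_sum, sum_cubeChar_mul_cubeChar]
  rw [Fintype.expect_eq_sum_div_card]
  simp

theorem expect_sq_eq_sum_fourierCoeffCube {n : ℕ} (f : Cube n → ℝ) :
    𝔼 x, f x ^ 2 = ∑ A, fourierCoeffCube f A ^ 2 := by
  rw [← expect_sum_cubeChar_sq]
  simp_rw [sum_fourierCoeffCube]

/-- The functions on the cube of degree at most `t`. -/
def lowDegree (n t : ℕ) : Submodule ℝ (Cube n → ℝ) :=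
  Submodule.span ℝ {f | ∃ A : Finset (Fin n), A.card ≤ t ∧ f = cubeChar A}

theorem cubeChar_mem_lowDegree {n t : ℕ} {A : Finset (Fin n)} (hA : A.card ≤ t) :
    cubeChar A ∈ lowDegree n t :=
  Submodule.subset_span ⟨A, hA, rfl⟩

theorem fourierCoeffCube_eq_zero_of_mem_lowDegree {n t : ℕ} {f : Cube n → ℝ}
    (hf : f ∈ lowDegree n t) {B : Finset (Fin n)} (hB : t < B.card) :
    fourierCoeffCube f B = 0 := by
  induction hf using Submodule.span_induction with
  | mem f hf =>
    obtain ⟨A, hA, rfl⟩ := hf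
    unfold fourierCoeffCube
    rw [expect_cubeChar_mul, if_neg]
    rintro rfl
    omega
  | zero => simp [fourierCoeffCube]
  | add f g _ _ hf hg =>
    simp only [fourierCoeffCube] at *
    simp [add_mul, Finset.expect_add_distrib, hf, hg]
  | smul a f _ hf =>
    simp only [fourierCoeffCube] at *
    simp [mul_assoc, ← Finset.mul_expect, hf]

theorem cubeDegree_le_of_mem_lowDegree {n t : ℕ} {f : Cube n → ℝ} (hf : f ∈ lowDegree n t) :
    cubeDegree f ≤ t := by
  unfold cubeDegree
  refine csSup_le' ?_
  rintro k ⟨A, hA, rfl⟩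
  by_contra h
  exact hA (fourierCoeffCube_eq_zero_of_mem_lowDegree hf (by omega))

theorem mul_mem_lowDegree {n a b : ℕ} {f g : Cube n → ℝ} (hf : f ∈ lowDegree n a)
    (hg : g ∈ lowDegree n b) : f * g ∈ lowDegree n (a + b) := by
  have h := Submodule.mul_mem_mul hf hg
  unfold lowDegree at h
  rw [Submodule.span_mul_span] at h
  refine Submodule.span_le.mpr ?_ h
  rintro _ ⟨_, ⟨A, hA, rfl⟩, _, ⟨B, hB, rfl⟩, rfl⟩
  have : (fun f g : Cube n → ℝ => f * g) (cubeChar A) (cubeChar B) = cubeChar (symmDiff A B) :=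
    funext fun x => cubeChar_mul A B x
  rw [this]
  refine cubeChar_mem_lowDegree ?_
  have h1 : (symmDiff A B).card ≤ (A ∪ B).card := Finset.card_le_card symmDiff_le_sup
  have h2 := Finset.card_union_le A B
  omega

theorem const_mem_lowDegree {n t : ℕ} (a : ℝ) : (fun _ => a) ∈ lowDegree n t := by
  have h := (lowDegree n t).smul_mem a (cubeChar_mem_lowDegree (A := ∅) (by simp))
  convert h using 1
  funext x
  simp [cubeChar]

/-! ### Restriction to the coordinates in a set -/

/-- The point that agrees with `y` on `S` and with `x` off `S`. -/
def cubeUpdate {n m : ℕ} (S : SubsetOfCard n m) (x : Cube n) (y : Cube m) : Cube n :=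
  fun i => if h : i ∈ S.1 then y ((S.1.orderIsoOfFin S.2).symm ⟨i, h⟩) else x i

theorem cubeRestrict_cubeUpdate {n m : ℕ} (S : SubsetOfCard n m) (x : Cube n) (y : Cube m) :
    cubeRestrict S (cubeUpdate S x y) = y := by
  funext k
  have h : S.1.orderEmbOfFin S.2 k ∈ S.1 := S.1.orderEmbOfFin_mem S.2 k
  have h2 : (⟨S.1.orderEmbOfFin S.2 k, h⟩ : S.1) = S.1.orderIsoOfFin S.2 k := by
    ext; simp
  simp only [cubeRestrict, cubeUpdate, dif_pos h, h2, OrderIso.symm_apply_apply]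

theorem cubeUpdate_cubeUpdate_cubeRestrict {n m : ℕ} (S : SubsetOfCard n m) (x : Cube n)
    (y : Cube m) : cubeUpdate S (cubeUpdate S x y) (cubeRestrict S x) = x := by
  funext i
  by_cases h : i ∈ S.1
  · simp only [cubeUpdate, dif_pos h, cubeRestrict]
    congr 1
    rw [← Finset.coe_orderIsoOfFin_apply, OrderIso.apply_symm_apply]
  · simp [cubeUpdate, h]

theorem expect_cubeUpdate {n m : ℕ} (S : SubsetOfCard n m) (F : Cube n → ℝ) :
    𝔼 x : Cube n, 𝔼 y : Cube m, F (cubeUpdate S x y) = 𝔼 x, F x := by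
  have hinv : Function.Involutive
      (fun p : Cube n × Cube m => (cubeUpdate S p.1 p.2, cubeRestrict S p.1)) := by
    rintro ⟨x, y⟩
    simp [cubeUpdate_cubeUpdate_cubeRestrict, cubeRestrict_cubeUpdate]
  have h1 : 𝔼 p : Cube n × Cube m, F (cubeUpdate S p.1 p.2) = 𝔼 p : Cube n × Cube m, F p.1 :=
    Fintype.expect_equiv hinv.toPerm _ _ fun p => rfl
  rw [← Finset.univ_product_univ, Finset.expect_product, Finset.expect_product] at h1
  simpa using h1

theorem cubeChar_cubeRestrict {n m : ℕ} (S : SubsetOfCard n m) (A : Finset (Fin m)) (x : Cube n) :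
    cubeChar A (cubeRestrict S x)
      = cubeChar (A.map (S.1.orderEmbOfFin S.2).toEmbedding) x := by
  simp [cubeChar, cubeRestrict, Finset.prod_map]

theorem comp_cubeRestrict_mem_lowDegree {n m : ℕ} (S : SubsetOfCard n m) (D : Cube m → ℝ) :
    (fun x => D (cubeRestrict S x)) ∈ lowDegree n m := by
  have h : (fun x => D (cubeRestrict S x))
      = ∑ A, fourierCoeffCube D A • cubeChar (A.map (S.1.orderEmbOfFin S.2).toEmbedding) := by
    funext x
    rw [← sum_fourierCoeffCube D]
    simp [cubeChar_cubeRestrict]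
  rw [h]
  refine Submodule.sum_mem _ fun A _ => Submodule.smul_mem _ _ (cubeChar_mem_lowDegree ?_)
  simpa using A.card_le_univ

theorem cubeChar_cubeUpdate {n m : ℕ} (S : SubsetOfCard n m) (A : Finset (Fin n)) (x : Cube n)
    (y : Cube m) :
    cubeChar A (cubeUpdate S x y) = cubeChar (A \ S.1) x *
      cubeChar (Finset.univ.filter fun k => S.1.orderEmbOfFin S.2 k ∈ A) y := by
  classical
  set e := S.1.orderEmbOfFin S.2
  have hmap : (Finset.univ.filter fun k => e k ∈ A).map e.toEmbedding = A ∩ S.1 := by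
    ext i
    simp only [Finset.mem_map, Finset.mem_filter, Finset.mem_univ, true_and,
      RelEmbedding.coe_toEmbedding, Finset.mem_inter]
    constructor
    · rintro ⟨k, hk, rfl⟩
      exact ⟨hk, S.1.orderEmbOfFin_mem S.2 k⟩
    · rintro ⟨hA, hS⟩
      have : i ∈ Set.range e := by simp [e, hS]
      obtain ⟨k, rfl⟩ := this
      exact ⟨k, hA, rfl⟩
  have h2 : cubeChar (Finset.univ.filter fun k => e k ∈ A) y
      = cubeChar (A ∩ S.1) (cubeUpdate S x y) := by
    rw [← hmap, ← cubeChar_cubeRestrict, cubeRestrict_cubeUpdate]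
  have h1 : cubeChar (A \ S.1) x = cubeChar (A \ S.1) (cubeUpdate S x y) := by
    refine Finset.prod_congr rfl fun i hi => ?_
    simp [cubeUpdate, (Finset.mem_sdiff.mp hi).2]
  rw [h1, h2]
  unfold cubeChar
  rw [mul_comm, Finset.prod_inter_mul_prod_sdiff]

theorem card_filter_orderEmbOfFin_mem {n m : ℕ} (S : SubsetOfCard n m) (A : Finset (Fin n)) :
    (Finset.univ.filter fun k => S.1.orderEmbOfFin S.2 k ∈ A).card ≤ (A ∩ S.1).card := by
  refine Finset.card_le_card_of_injOn (S.1.orderEmbOfFin S.2) ?_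
    (S.1.orderEmbOfFin S.2).injective.injOn
  intro k hk
  simp only [Finset.coe_filter, Finset.mem_univ, true_and, Set.mem_ofPred_eq] at hk
  simp [hk]

/-- The part of `f` of degree at least `s` in the coordinates in `S`. -/
noncomputable def highPart {n : ℕ} (s : ℕ) (S : Finset (Fin n)) (f : Cube n → ℝ) : Cube n → ℝ :=
  fun x => ∑ A, (if s ≤ (A ∩ S).card then fourierCoeffCube f A else 0) * cubeChar A x

theorem sub_highPart {n : ℕ} (s : ℕ) (S : Finset (Fin n)) (f : Cube n → ℝ) (x : Cube n) :
    f x - highPart s S f x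
      = ∑ A, (if (A ∩ S).card < s then fourierCoeffCube f A else 0) * cubeChar A x := by
  rw [← sum_fourierCoeffCube f x, highPart, ← Finset.sum_sub_distrib]
  refine Finset.sum_congr rfl fun A _ => ?_
  simp_rw [← not_le]
  split_ifs <;> simp

theorem fourierCoeffCube_sum_mul {n : ℕ} {ι : Type*} (t : Finset ι) (c : ι → ℝ)
    (f : ι → Cube n → ℝ) (A : Finset (Fin n)) :
    fourierCoeffCube (fun x => ∑ i ∈ t, c i * f i x) A
      = ∑ i ∈ t, c i * fourierCoeffCube (f i) A := by
  unfold fourierCoeffCube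
  simp_rw [Finset.sum_mul, Finset.expect_sum_comm, Finset.mul_expect, mul_assoc]

theorem highPart_sum_mul {n : ℕ} {ι : Type*} (s : ℕ) (S : Finset (Fin n)) (t : Finset ι)
    (c : ι → ℝ) (f : ι → Cube n → ℝ) (x : Cube n) :
    highPart s S (fun x => ∑ i ∈ t, c i * f i x) x = ∑ i ∈ t, c i * highPart s S (f i) x := by
  unfold highPart
  simp_rw [fourierCoeffCube_sum_mul, Finset.mul_sum]
  rw [Finset.sum_comm]
  refine Finset.sum_congr rfl fun A _ => ?_
  split_ifs
  · rw [Finset.sum_mul]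
    exact Finset.sum_congr rfl fun i _ => by ring
  · simp

theorem expect_mul_sub_highPart_sq_nonneg {n m d : ℕ} {D : Cube m → ℝ} (hD : IsPseudoDensity d D)
    (S : SubsetOfCard n m) (f : Cube n → ℝ) :
    0 ≤ 𝔼 x, D (cubeRestrict S x) * (f x - highPart (d / 2 + 1) S.1 f x) ^ 2 := by
  rw [← expect_cubeUpdate S]
  refine Finset.expect_nonneg fun x _ => ?_
  simp_rw [cubeRestrict_cubeUpdate, sub_highPart, cubeChar_cubeUpdate]
  refine hD.2 (fun y => _) ?_
  have h : (cubeDegree fun y : Cube m => ∑ A : Finset (Fin n),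
      (if (A ∩ S.1).card < d / 2 + 1 then fourierCoeffCube f A else 0) * (cubeChar (A \ S.1) x *
        cubeChar (Finset.univ.filter fun k => S.1.orderEmbOfFin S.2 k ∈ A) y)) ≤ d / 2 := by
    refine cubeDegree_le_of_mem_lowDegree ?_
    have : (fun y : Cube m => ∑ A : Finset (Fin n),
      (if (A ∩ S.1).card < d / 2 + 1 then fourierCoeffCube f A else 0) * (cubeChar (A \ S.1) x *
        cubeChar (Finset.univ.filter fun k => S.1.orderEmbOfFin S.2 k ∈ A) y))
      = ∑ A : Finset (Fin n), ((if (A ∩ S.1).card < d / 2 + 1 then fourierCoeffCube f A else 0) *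
        cubeChar (A \ S.1) x) •
        cubeChar (Finset.univ.filter fun k => S.1.orderEmbOfFin S.2 k ∈ A) := by
      funext y
      simp only [Finset.sum_apply, Pi.smul_apply, smul_eq_mul, mul_assoc]
    rw [this]
    refine Submodule.sum_mem _ fun A _ => ?_
    by_cases hA : (A ∩ S.1).card < d / 2 + 1
    · refine Submodule.smul_mem _ _ (cubeChar_mem_lowDegree ?_)
      have := card_filter_orderEmbOfFin_mem S A
      omega
    · simp [hA]
  rw [le_div_iff₀ (by norm_num)]
  have h2 : (d / 2) * 2 ≤ d := Nat.div_mul_le_self d 2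
  exact_mod_cast (Nat.mul_le_mul_right 2 h).trans h2

theorem abs_le_norm_cubeRestrict {n m : ℕ} (D : Cube m → ℝ) (S : SubsetOfCard n m) (x : Cube n) :
    |D (cubeRestrict S x)| ≤ ‖D‖ :=
  norm_le_pi_norm D _

theorem neg_le_expect_mul_sq {n m d : ℕ} {D : Cube m → ℝ} (hD : IsPseudoDensity d D)
    (S : SubsetOfCard n m) (f : Cube n → ℝ) {θ : ℝ} (hθ : 0 < θ) :
    -(‖D‖ * (θ * 𝔼 x, f x ^ 2 + (1 / θ + 1) * 𝔼 x, highPart (d / 2 + 1) S.1 f x ^ 2))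
      ≤ 𝔼 x, D (cubeRestrict S x) * f x ^ 2 := by
  have h0 := expect_mul_sub_highPart_sq_nonneg hD S f
  set H := highPart (d / 2 + 1) S.1 f
  refine le_trans (le_add_of_nonneg_right h0) ?_
  rw [Finset.mul_expect, Finset.mul_expect, ← Finset.expect_add_distrib, Finset.mul_expect,
    ← Finset.expect_neg_distrib, ← Finset.expect_add_distrib]
  refine Finset.expect_le_expect fun x _ => ?_
  have hD1 := abs_le_norm_cubeRestrict D S x
  have key : |f x ^ 2 - (f x - H x) ^ 2| ≤ θ * f x ^ 2 + (1 / θ + 1) * H x ^ 2 := by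
    have e : θ * f x ^ 2 + 1 / θ * H x ^ 2 - 2 * |f x * H x| = θ * (|f x| - |H x| / θ) ^ 2 := by
      rw [abs_mul, ← sq_abs (f x), ← sq_abs (H x)]
      field_simp
      ring
    have e2 : 0 ≤ θ * (|f x| - |H x| / θ) ^ 2 := by positivity
    have e3 : f x ^ 2 - (f x - H x) ^ 2 = 2 * (f x * H x) - H x ^ 2 := by ring
    rw [e3, abs_le]
    have := le_abs_self (f x * H x)
    have := neg_abs_le (f x * H x)
    have := sq_nonneg (H x)
    constructor <;> linarith
  have h3 : |D (cubeRestrict S x) * (f x ^ 2 - (f x - H x) ^ 2)|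
      ≤ ‖D‖ * (θ * f x ^ 2 + (1 / θ + 1) * H x ^ 2) := by
    rw [abs_mul]
    exact mul_le_mul hD1 key (abs_nonneg _) (norm_nonneg _)
  have h4 := (abs_le.mp h3).1
  linarith

/-! ### Random restrictions -/

theorem descFactorial_mul_pow_le {m n : ℕ} (h : m ≤ n) (s : ℕ) :
    m.descFactorial s * n ^ s ≤ n.descFactorial s * m ^ s := by
  induction s with
  | zero => simp
  | succ s ih =>
    rw [Nat.descFactorial_succ, Nat.descFactorial_succ, pow_succ, pow_succ]
    have h1 : (m - s) * n ≤ (n - s) * m := by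
      rw [Nat.sub_mul, Nat.sub_mul, Nat.mul_comm n m]
      have : s * m ≤ s * n := Nat.mul_le_mul_left s h
      omega
    calc (m - s) * m.descFactorial s * (n ^ s * n)
        = ((m - s) * n) * (m.descFactorial s * n ^ s) := by ring
      _ ≤ ((n - s) * m) * (n.descFactorial s * m ^ s) := Nat.mul_le_mul h1 ih
      _ = (n - s) * n.descFactorial s * (m ^ s * m) := by ring

theorem choose_mul_pow_le {m n : ℕ} (h : m ≤ n) (s : ℕ) :
    m.choose s * n ^ s ≤ n.choose s * m ^ s := by
  have h1 := descFactorial_mul_pow_le h s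
  rw [Nat.descFactorial_eq_factorial_mul_choose, Nat.descFactorial_eq_factorial_mul_choose,
    mul_assoc, mul_assoc] at h1
  exact Nat.le_of_mul_le_mul_left h1 (Nat.factorial_pos s)

theorem card_filter_subset_mul_pow_le {n m : ℕ} (hmn : m ≤ n) (B : Finset (Fin n)) :
    (Finset.univ.filter fun S : SubsetOfCard n m => B ⊆ S.1).card * n ^ B.card
      ≤ n.choose m * m ^ B.card := by
  have hcard : (Finset.univ.filter fun S : SubsetOfCard n m => B ⊆ S.1).card
      = ((Finset.powersetCard m Finset.univ).filter fun S : Finset (Fin n) => B ⊆ S).card := by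
    refine Finset.card_bij (fun S _ => S.1) ?_ ?_ ?_
    · intro S hS
      simp only [Finset.mem_filter, Finset.mem_univ, true_and] at hS
      simp [S.2, hS]
    · intro S _ S' _ h
      exact Subtype.ext h
    · intro S hS
      simp only [Finset.mem_filter, Finset.mem_powersetCard, Finset.subset_univ, true_and] at hS
      exact ⟨⟨S, hS.1⟩, by simp [hS.2], rfl⟩
  rw [hcard]
  by_cases hB : B.card ≤ m
  · rw [Finset.card_filter_powersetCard_subset B Finset.univ m (Finset.subset_univ _) hB]
    simp only [Finset.card_univ, Fintype.card_fin]
    have h1 := Nat.choose_mul (n := n) (k := m) (s := B.card) hB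
    have h2 := choose_mul_pow_le hmn B.card
    have h3 : 0 < n.choose B.card := Nat.choose_pos (hB.trans hmn)
    refine Nat.le_of_mul_le_mul_left (c := n.choose B.card) ?_ h3
    calc n.choose B.card * ((n - B.card).choose (m - B.card) * n ^ B.card)
        = n.choose m * (m.choose B.card * n ^ B.card) := by rw [← mul_assoc, ← h1, mul_assoc]
      _ ≤ n.choose m * (n.choose B.card * m ^ B.card) := Nat.mul_le_mul_left _ h2
      _ = _ := by ring
  · have : ((Finset.powersetCard m Finset.univ).filter fun S : Finset (Fin n) => B ⊆ S) = ∅ := by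
      refine Finset.filter_eq_empty_iff.mpr fun S hS hBS => hB ?_
      rw [← (Finset.mem_powersetCard.mp hS).2]
      exact Finset.card_le_card hBS
    simp [this]

theorem card_subsetOfCard (n m : ℕ) : Fintype.card (SubsetOfCard n m) = n.choose m := by
  simp

theorem expect_card_inter_ge {n m : ℕ} (hn : 0 < n) (hmn : m ≤ n) (s : ℕ) (A : Finset (Fin n)) :
    𝔼 S : SubsetOfCard n m, (if s ≤ (A ∩ S.1).card then (1 : ℝ) else 0)
      ≤ ((A.card : ℝ) * m / n) ^ s := by
  have h1 : (Finset.univ.filter fun S : SubsetOfCard n m => s ≤ (A ∩ S.1).card).card * n ^ s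
      ≤ A.card ^ s * (n.choose m * m ^ s) := by
    have hsub : (Finset.univ.filter fun S : SubsetOfCard n m => s ≤ (A ∩ S.1).card)
        ⊆ (Finset.powersetCard s A).biUnion fun B =>
          Finset.univ.filter fun S : SubsetOfCard n m => B ⊆ S.1 := by
      intro S hS
      simp only [Finset.mem_filter, Finset.mem_univ, true_and] at hS
      obtain ⟨B, hB, hBs⟩ := Finset.exists_subset_card_eq hS
      simp only [Finset.mem_biUnion, Finset.mem_powersetCard, Finset.mem_filter, Finset.mem_univ,
        true_and]
      exact ⟨B, ⟨hB.trans Finset.inter_subset_left, hBs⟩, hB.trans Finset.inter_subset_right⟩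
    calc _ ≤ (∑ B ∈ Finset.powersetCard s A,
          (Finset.univ.filter fun S : SubsetOfCard n m => B ⊆ S.1).card) * n ^ s :=
          Nat.mul_le_mul_right _ ((Finset.card_le_card hsub).trans Finset.card_biUnion_le)
      _ = ∑ B ∈ Finset.powersetCard s A,
          (Finset.univ.filter fun S : SubsetOfCard n m => B ⊆ S.1).card * n ^ s :=
          Finset.sum_mul _ _ _
      _ ≤ ∑ B ∈ Finset.powersetCard s A, n.choose m * m ^ s := by
          refine Finset.sum_le_sum fun B hB => ?_
          have := card_filter_subset_mul_pow_le hmn B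
          rwa [(Finset.mem_powersetCard.mp hB).2] at this
      _ = (A.card.choose s) * (n.choose m * m ^ s) := by simp
      _ ≤ _ := Nat.mul_le_mul_right _ (Nat.choose_le_pow _ _)
  rw [Fintype.expect_eq_sum_div_card, card_subsetOfCard, Finset.sum_boole]
  have hc : (0 : ℝ) < n.choose m := by exact_mod_cast Nat.choose_pos hmn
  have hn' : (0 : ℝ) < n := by exact_mod_cast hn
  rw [div_pow, mul_pow, div_le_div_iff₀ hc (by positivity)]
  have h2 : (((Finset.univ.filter fun S : SubsetOfCard n m =>
      s ≤ (A ∩ S.1).card).card : ℝ)) * (n : ℝ) ^ s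
      ≤ (A.card : ℝ) ^ s * (n.choose m * (m : ℝ) ^ s) := by exact_mod_cast h1
  linarith

theorem expect_highPart_sq_le {n m s t : ℕ} (hn : 0 < n) (hmn : m ≤ n) {f : Cube n → ℝ}
    (hf : f ∈ lowDegree n t) :
    𝔼 S : SubsetOfCard n m, 𝔼 x, highPart s S.1 f x ^ 2
      ≤ ((t : ℝ) * m / n) ^ s * 𝔼 x, f x ^ 2 := by
  unfold highPart
  simp_rw [expect_sum_cubeChar_sq]
  rw [Finset.expect_sum_comm, expect_sq_eq_sum_fourierCoeffCube, Finset.mul_sum]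
  refine Finset.sum_le_sum fun A _ => ?_
  by_cases hA : t < A.card
  · simp [fourierCoeffCube_eq_zero_of_mem_lowDegree hf hA]
  · have h1 : ∀ S : SubsetOfCard n m,
        (if s ≤ (A ∩ S.1).card then fourierCoeffCube f A else 0) ^ 2
          = (if s ≤ (A ∩ S.1).card then (1 : ℝ) else 0) * fourierCoeffCube f A ^ 2 := by
      intro S
      split_ifs <;> simp
    simp_rw [h1]
    rw [← Finset.expect_mul]
    refine mul_le_mul_of_nonneg_right ?_ (sq_nonneg _)
    refine (expect_card_inter_ge hn hmn s A).trans ?_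
    have : (A.card : ℝ) ≤ t := by exact_mod_cast not_lt.mp hA
    gcongr

/-! ### Positive semidefinite matrices -/

section Matrices

open Matrix

theorem Matrix.PosSemidef.transpose_mul_mul_same_real {m n : Type*} [Fintype m] [Fintype n]
    {A : Matrix n n ℝ} (hA : A.PosSemidef) (B : Matrix n m ℝ) : (Bᵀ * A * B).PosSemidef := by
  simpa using hA.conjTranspose_mul_mul_same B

theorem Matrix.PosSemidef.mul_mul_transpose_same_real {m n : Type*} [Fintype m] [Fintype n]
    {A : Matrix n n ℝ} (hA : A.PosSemidef) (B : Matrix m n ℝ) : (B * A * Bᵀ).PosSemidef := by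
  simpa using hA.mul_mul_conjTranspose_same B

theorem Matrix.PosSemidef.transpose_eq_real {n : Type*} [Fintype n]
    {A : Matrix n n ℝ} (hA : A.PosSemidef) : Aᵀ = A := by
  simpa using hA.isHermitian.eq

theorem Matrix.PosSemidef.dotProduct_nonneg_real {n : Type*} [Fintype n]
    {A : Matrix n n ℝ} (hA : A.PosSemidef) (v : n → ℝ) : 0 ≤ v ⬝ᵥ A *ᵥ v := by
  simpa using hA.dotProduct_mulVec_nonneg v

theorem Matrix.PosSemidef.exists_eq_mul_diagonal_mul {n : Type*} [Fintype n] [DecidableEq n]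
    {A : Matrix n n ℝ} (hA : A.PosSemidef) :
    ∃ (U : Matrix n n ℝ) (μ : n → ℝ), Uᵀ * U = 1 ∧ U * Uᵀ = 1 ∧ (∀ i, 0 ≤ μ i) ∧
      A = U * diagonal μ * Uᵀ := by
  refine ⟨hA.1.eigenvectorUnitary, hA.1.eigenvalues, ?_, ?_, hA.eigenvalues_nonneg, ?_⟩
  · simpa [star_eq_conjTranspose] using
      Unitary.coe_star_mul_self hA.1.eigenvectorUnitary
  · simpa [star_eq_conjTranspose] using
      Unitary.coe_mul_star_self hA.1.eigenvectorUnitary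
  · have h := hA.1.spectral_theorem
    rw [Unitary.conjStarAlgAut_apply] at h
    simpa [star_eq_conjTranspose, Function.comp_def] using h

theorem Matrix.PosSemidef.exists_eq_transpose_mul_self {n : Type*} [Fintype n] [DecidableEq n]
    {A : Matrix n n ℝ} (hA : A.PosSemidef) : ∃ G : Matrix n n ℝ, A = Gᵀ * G := by
  obtain ⟨U, μ, -, -, hμ, h⟩ := hA.exists_eq_mul_diagonal_mul
  refine ⟨diagonal (fun i => Real.sqrt (μ i)) * Uᵀ, ?_⟩
  have h2 : diagonal μ
      = diagonal (fun i => Real.sqrt (μ i)) * diagonal (fun i => Real.sqrt (μ i)) := by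
    rw [diagonal_mul_diagonal]
    congr 1
    funext i
    exact (Real.mul_self_sqrt (hμ i)).symm
  rw [h, h2, transpose_mul, diagonal_transpose, transpose_transpose]
  simp only [Matrix.mul_assoc]

theorem Matrix.PosSemidef.trace_mul_nonneg {n : Type*} [Fintype n] [DecidableEq n]
    {A B : Matrix n n ℝ} (hA : A.PosSemidef) (hB : B.PosSemidef) : 0 ≤ (A * B).trace := by
  obtain ⟨G, rfl⟩ := hA.exists_eq_transpose_mul_self
  rw [Matrix.mul_assoc, trace_mul_comm]
  exact (hB.mul_mul_transpose_same_real G).trace_nonneg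

theorem Matrix.PosSemidef.trace_smul_one_sub {n : Type*} [Fintype n] [DecidableEq n]
    {A : Matrix n n ℝ} (hA : A.PosSemidef) :
    (A.trace • (1 : Matrix n n ℝ) - A).PosSemidef := by
  obtain ⟨U, μ, h1, h2, hμ, h⟩ := hA.exists_eq_mul_diagonal_mul
  have htr : A.trace = ∑ i, μ i := by
    rw [h, trace_mul_comm, ← Matrix.mul_assoc, h1, Matrix.one_mul, trace_diagonal]
  have hd : (diagonal fun i => (∑ j, μ j) - μ i).PosSemidef := by
    refine PosSemidef.diagonal fun i => ?_
    exact sub_nonneg.mpr (Finset.single_le_sum (fun j _ => hμ j) (Finset.mem_univ i))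
  have h3 := hd.mul_mul_transpose_same_real U
  have h4 : (diagonal fun i => (∑ j, μ j) - μ i)
      = (∑ j, μ j) • (1 : Matrix n n ℝ) - diagonal μ := by
    ext i j
    by_cases hij : i = j
    · subst hij; simp
    · simp [hij]
  rw [h4, Matrix.mul_sub, Matrix.sub_mul, ← h, Matrix.mul_smul, Matrix.smul_mul, Matrix.mul_one, h2,
    ← htr] at h3
  exact h3

theorem Matrix.PosSemidef.dotProduct_le_trace_mul {n : Type*} [Fintype n] [DecidableEq n]
    {A : Matrix n n ℝ} (hA : A.PosSemidef) (v : n → ℝ) :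
    v ⬝ᵥ A *ᵥ v ≤ A.trace * (v ⬝ᵥ v) := by
  have h := hA.trace_smul_one_sub.dotProduct_nonneg_real v
  rw [Matrix.sub_mulVec, dotProduct_sub, Matrix.smul_mulVec, Matrix.one_mulVec, dotProduct_smul,
    smul_eq_mul] at h
  linarith

theorem dotProduct_transpose_mul_mul_mulVec {m n : Type*} [Fintype m] [Fintype n]
    (G : Matrix m n ℝ) (A : Matrix m m ℝ) (v : n → ℝ) :
    v ⬝ᵥ (Gᵀ * A * G) *ᵥ v = (G *ᵥ v) ⬝ᵥ A *ᵥ (G *ᵥ v) := by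
  rw [← Matrix.mulVec_mulVec, ← Matrix.mulVec_mulVec, dotProduct_mulVec v, vecMul_transpose]

theorem Matrix.PosSemidef.dotProduct_mulVec_mulVec_le {n : Type*} [Fintype n] [DecidableEq n]
    {A B : Matrix n n ℝ} (hA : A.PosSemidef) (hB : B.PosSemidef) (v : n → ℝ) :
    (A *ᵥ v) ⬝ᵥ B *ᵥ (A *ᵥ v) ≤ (A * B).trace * (v ⬝ᵥ A *ᵥ v) := by
  obtain ⟨G, rfl⟩ := hA.exists_eq_transpose_mul_self
  have h := (hB.mul_mul_transpose_same_real G).dotProduct_le_trace_mul (G *ᵥ v)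
  have h1 := dotProduct_transpose_mul_mul_mulVec Gᵀ B (G *ᵥ v)
  have h2 := dotProduct_transpose_mul_mul_mulVec G 1 v
  rw [Matrix.mul_one, Matrix.one_mulVec] at h2
  rw [Matrix.transpose_transpose] at h1
  rw [h1, Matrix.mulVec_mulVec] at h
  rwa [h2, Matrix.mul_assoc, trace_mul_comm]

/-- A family of vectors in a compact set maximizing the volume spans every vector of the set with
coefficients in `[-1, 1]`. -/
theorem exists_auerbach_family {r : ℕ} {Ω : Set (Fin r → ℝ)} (hc : IsCompact Ω) {δ : ℝ}
    (hδ : δ ≠ 0) (hΩ : ∀ i : Fin r, Pi.single i δ ∈ Ω) :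
    ∃ U : Matrix (Fin r) (Fin r) ℝ, U.det ≠ 0 ∧ (∀ i, U i ∈ Ω) ∧
      ∀ u ∈ Ω, ∃ c : Fin r → ℝ, (∀ i, |c i| ≤ 1) ∧ u = ∑ i, c i • U i := by
  have hK : IsCompact (Set.univ.pi fun _ : Fin r => Ω) := isCompact_univ_pi fun _ => hc
  have hmem : (diagonal fun _ : Fin r => δ) ∈ (Set.univ.pi fun _ : Fin r => Ω) := by
    intro i _
    convert hΩ i using 1
    ext j
    by_cases hij : i = j
    · subst hij; simp
    · simp [hij, Ne.symm hij]
  have hcont : ContinuousOn (fun U : Matrix (Fin r) (Fin r) ℝ => |U.det|)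
      (Set.univ.pi fun _ : Fin r => Ω) :=
    (continuous_abs.comp (Continuous.matrix_det continuous_id)).continuousOn
  obtain ⟨U, hU, hmax⟩ : ∃ U : Matrix (Fin r) (Fin r) ℝ, U ∈ (Set.univ.pi fun _ : Fin r => Ω) ∧
      IsMaxOn (fun U : Matrix (Fin r) (Fin r) ℝ => |U.det|) (Set.univ.pi fun _ : Fin r => Ω) U :=
    hK.exists_isMaxOn ⟨_, hmem⟩ hcont
  have hpos : 0 < |U.det| := by
    have h1 : |(diagonal fun _ : Fin r => δ).det| ≤ |U.det| := hmax hmem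
    refine lt_of_lt_of_le ?_ h1
    rw [det_diagonal]
    simpa using pow_pos (abs_pos.mpr hδ) r
  have hdet : U.det ≠ 0 := abs_pos.mp hpos
  refine ⟨U, hdet, fun i => hU i (Set.mem_univ i), fun u hu => ?_⟩
  have hu2 : u = ∑ i, (u ᵥ* U⁻¹) i • U i := by
    have h1 : (u ᵥ* U⁻¹) ᵥ* U = u := by
      rw [vecMul_vecMul, nonsing_inv_mul U (isUnit_iff_ne_zero.mpr hdet), vecMul_one]
    rw [← vecMul_eq_sum]
    exact h1.symm
  refine ⟨u ᵥ* U⁻¹, fun i => ?_, hu2⟩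
  have h2 := det_updateRow_sum U i (u ᵥ* U⁻¹)
  rw [← hu2, smul_eq_mul] at h2
  have h3 : U.updateRow i u ∈ (Set.univ.pi fun _ : Fin r => Ω) := by
    intro j _
    by_cases hij : j = i
    · subst hij; simpa using hu
    · simpa [hij] using hU j (Set.mem_univ j)
  have h4 : |(U.updateRow i u).det| ≤ |U.det| := hmax h3
  rw [h2, abs_mul] at h4
  exact le_of_mul_le_mul_right (by linarith) hpos

theorem exists_posSemidef_dominating {ι κ : Type*} [Finite ι] [Finite κ] {r : ℕ}
    (A : ι → Matrix (Fin r) (Fin r) ℝ) (B : κ → Matrix (Fin r) (Fin r) ℝ)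
    (hA : ∀ i, (A i).PosSemidef) (hB : ∀ j, (B j).PosSemidef)
    (hAB : ∀ i j, (A i * B j).trace ≤ 1) :
    ∃ V : Matrix (Fin r) (Fin r) ℝ, V.PosSemidef ∧ (r ≠ 0 → V.det ≠ 0) ∧
      (∀ i, (V - A i).PosSemidef) ∧ ∀ j, (V * B j).trace ≤ (r : ℝ) ^ 2 := by
  have := Fintype.ofFinite ι
  have := Fintype.ofFinite κ
  set R : ℝ := 1 + ∑ i, (A i).trace with hR
  have hR1 : ∀ i, (A i).trace ≤ R := by
    intro i
    have := Finset.single_le_sum (f := fun i => (A i).trace)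
      (fun i _ => (hA i).trace_nonneg) (Finset.mem_univ i)
    linarith
  have hR0 : 1 ≤ R := by
    have := Finset.sum_nonneg (s := Finset.univ) fun i (_ : i ∈ Finset.univ) =>
      (hA i).trace_nonneg
    linarith
  set Ω : Set (Fin r → ℝ) := {u | (∀ j, u ⬝ᵥ B j *ᵥ u ≤ 1) ∧ u ⬝ᵥ u ≤ R}
  have hclosed : IsClosed Ω := by
    have h1 : IsClosed {u : Fin r → ℝ | ∀ j, u ⬝ᵥ B j *ᵥ u ≤ 1} := by
      simp only [Set.ofPred_forall]
      refine isClosed_iInter fun j => isClosed_le ?_ continuous_const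
      exact continuous_id.dotProduct (continuous_const.matrix_mulVec continuous_id)
    exact h1.inter (isClosed_le (continuous_id.dotProduct continuous_id) continuous_const)
  have hcompact : IsCompact Ω := by
    refine Metric.isCompact_of_isClosed_isBounded hclosed ?_
    refine (Metric.isBounded_closedBall (x := (0 : Fin r → ℝ)) (r := R)).subset fun u hu => ?_
    rw [mem_closedBall_zero_iff, pi_norm_le_iff_of_nonneg (by linarith)]
    intro i
    have h1 : u i * u i ≤ u ⬝ᵥ u :=
      Finset.single_le_sum (f := fun i => u i * u i) (fun i _ => mul_self_nonneg _)
        (Finset.mem_univ i)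
    have h2 := hu.2
    rw [Real.norm_eq_abs]
    refine abs_le_of_sq_le_sq ?_ (by linarith)
    nlinarith
  obtain ⟨δ, hδ, hΩ⟩ : ∃ δ : ℝ, δ ≠ 0 ∧ ∀ i : Fin r, Pi.single i δ ∈ Ω := by
    set b : ℝ := 1 + ∑ j, (B j).trace with hb
    have hb1 : 1 ≤ b := by
      have := Finset.sum_nonneg (s := Finset.univ) fun i (_ : i ∈ Finset.univ) =>
        (hB i).trace_nonneg
      linarith
    have hb2 : ∀ j, (B j).trace ≤ b := by
      intro j
      have := Finset.single_le_sum (f := fun i => (B i).trace)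
        (fun i _ => (hB i).trace_nonneg) (Finset.mem_univ j)
      linarith
    have hss : ∀ i : Fin r, (Pi.single i b⁻¹ : Fin r → ℝ) ⬝ᵥ Pi.single i b⁻¹ = b⁻¹ * b⁻¹ := by
      intro i; simp
    have hbi : b⁻¹ ≤ 1 := inv_le_one_of_one_le₀ hb1
    have hbi0 : 0 < b⁻¹ := by positivity
    refine ⟨b⁻¹, hbi0.ne', fun i => ⟨fun j => ?_, ?_⟩⟩
    · refine ((hB j).dotProduct_le_trace_mul _).trans ?_
      rw [hss]
      calc (B j).trace * (b⁻¹ * b⁻¹) ≤ b * (b⁻¹ * b⁻¹) := by gcongr; exact hb2 j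
        _ = b⁻¹ := by field_simp
        _ ≤ 1 := hbi
    · rw [hss]
      nlinarith
  obtain ⟨U, hdet, hU, hspan⟩ := exists_auerbach_family hcompact hδ hΩ
  have hV : ∀ X : Matrix (Fin r) (Fin r) ℝ,
      ((r : ℝ) • (Uᵀ * U) * X).trace = r * ∑ i, U i ⬝ᵥ X *ᵥ U i := by
    intro X
    rw [smul_mul, trace_smul, smul_eq_mul, Matrix.mul_assoc, trace_mul_comm]
    congr 1
    refine Finset.sum_congr rfl fun i _ => ?_
    rw [dotProduct_mulVec]
    rfl
  have hpsd : ((r : ℝ) • (Uᵀ * U)).PosSemidef := by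
    have h := (PosSemidef.one (n := Fin r) (R := ℝ)).transpose_mul_mul_same_real U
    rw [Matrix.mul_one] at h
    exact h.smul (Nat.cast_nonneg r)
  refine ⟨(r : ℝ) • (Uᵀ * U), hpsd, ?_, ?_, ?_⟩
  · intro hr
    rw [det_smul, det_mul, det_transpose]
    have : (r : ℝ) ≠ 0 := by exact_mod_cast hr
    positivity
  · intro s
    refine PosSemidef.of_dotProduct_mulVec_nonneg (hpsd.1.sub (hA s).1) fun v => ?_
    rw [star_trivial, Matrix.sub_mulVec, dotProduct_sub, sub_nonneg]
    have hquad : v ⬝ᵥ ((r : ℝ) • (Uᵀ * U)) *ᵥ v = r * ∑ i, (U i ⬝ᵥ v) ^ 2 := by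
      have := dotProduct_transpose_mul_mul_mulVec U 1 v
      rw [Matrix.mul_one, Matrix.one_mulVec] at this
      rw [Matrix.smul_mulVec, dotProduct_smul, this, smul_eq_mul]
      congr 1
      simp [dotProduct, mulVec, pow_two]
    rw [hquad]
    set a := v ⬝ᵥ A s *ᵥ v with ha
    have ha0 : 0 ≤ a := (hA s).dotProduct_nonneg_real v
    rcases ha0.eq_or_lt with h0 | hpos
    · rw [← h0]; positivity
    have hsq : 0 < Real.sqrt a := Real.sqrt_pos.mpr hpos
    have hsq2 : (Real.sqrt a)⁻¹ * ((Real.sqrt a)⁻¹ * a) = 1 := by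
      have := Real.mul_self_sqrt ha0
      field_simp
      nlinarith
    have hmem : (Real.sqrt a)⁻¹ • (A s *ᵥ v) ∈ Ω := by
      constructor
      · intro j
        rw [Matrix.mulVec_smul, dotProduct_smul, smul_dotProduct, smul_eq_mul, smul_eq_mul,
          ← hsq2]
        gcongr
        refine ((hA s).dotProduct_mulVec_mulVec_le (hB j) v).trans ?_
        nlinarith [hAB s j]
      · rw [dotProduct_smul, smul_dotProduct, smul_eq_mul, smul_eq_mul]
        have h1 := (hA s).dotProduct_mulVec_mulVec_le PosSemidef.one v
        rw [Matrix.one_mulVec, Matrix.mul_one] at h1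
        calc _ ≤ (Real.sqrt a)⁻¹ * ((Real.sqrt a)⁻¹ * (R * a)) := by
              gcongr
              exact h1.trans (mul_le_mul_of_nonneg_right (hR1 s) ha0)
          _ = R * ((Real.sqrt a)⁻¹ * ((Real.sqrt a)⁻¹ * a)) := by ring
          _ = R := by rw [hsq2, mul_one]
          _ ≤ R := le_rfl
    obtain ⟨c, hc, hcu⟩ := hspan _ hmem
    have h5 : Real.sqrt a = ∑ i, c i * (U i ⬝ᵥ v) := by
      have h6 := congrArg (fun u => u ⬝ᵥ v) hcu
      simp only [smul_dotProduct, smul_eq_mul, sum_dotProduct] at h6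
      rw [← h6, dotProduct_comm, ← ha]
      have := Real.mul_self_sqrt ha0
      field_simp
      nlinarith
    have h7 := Finset.sum_mul_sq_le_sq_mul_sq Finset.univ c fun i => U i ⬝ᵥ v
    rw [← h5, Real.sq_sqrt ha0] at h7
    refine h7.trans (mul_le_mul_of_nonneg_right ?_ (by positivity))
    calc ∑ i, c i ^ 2 ≤ ∑ i : Fin r, (1 : ℝ) :=
          Finset.sum_le_sum fun i _ => by
            rw [← sq_abs]
            exact pow_le_one₀ (abs_nonneg _) (hc i)
      _ = r := by simp
  · intro j
    rw [hV, pow_two]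
    gcongr
    calc ∑ i, U i ⬝ᵥ B j *ᵥ U i ≤ ∑ i : Fin r, (1 : ℝ) :=
          Finset.sum_le_sum fun i _ => (hU i).1 j
      _ = r := by simp

/-- A psd factorization of a matrix with entries at most `1` can be rescaled so that the left
factors have average at most `1` and norm at most `r ^ 2`, while the right factors have trace at
most `2`. -/
theorem exists_rescaled_factorization {ι κ : Type*} [Fintype ι] [Nonempty ι] [Finite κ] {r : ℕ}
    (hr : r ≠ 0) (A : ι → Matrix (Fin r) (Fin r) ℝ) (B : κ → Matrix (Fin r) (Fin r) ℝ)
    (hA : ∀ i, (A i).PosSemidef) (hB : ∀ j, (B j).PosSemidef)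
    (hAB : ∀ i j, (A i * B j).trace ≤ 1) :
    ∃ (A' : ι → Matrix (Fin r) (Fin r) ℝ) (B' : κ → Matrix (Fin r) (Fin r) ℝ),
      (∀ i, (A' i).PosSemidef) ∧ (∀ j, (B' j).PosSemidef) ∧
      (∀ i j, (A' i * B' j).trace = (A i * B j).trace) ∧
      (∀ i, ((r : ℝ) ^ 2 • (1 : Matrix (Fin r) (Fin r) ℝ) - A' i).PosSemidef) ∧
      (1 - (Fintype.card ι : ℝ)⁻¹ • ∑ i, A' i).PosSemidef ∧
      ∀ j, (B' j).trace ≤ 2 := by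
  obtain ⟨V, hV, hVdet, hVA, hVB⟩ := exists_posSemidef_dominating A B hA hB hAB
  have hr0 : (0 : ℝ) < (r : ℝ) ^ 2 := by positivity
  set c : ℝ := (Fintype.card ι : ℝ)⁻¹ with hc
  have hc0 : 0 ≤ c := by positivity
  set E : Matrix (Fin r) (Fin r) ℝ := c • ∑ i, A i with hE
  have hEpsd : E.PosSemidef := (posSemidef_sum _ fun i _ => hA i).smul hc0
  set W := E + ((r : ℝ) ^ 2)⁻¹ • V with hW
  have hVpd : V.PosDef := (hV.posDef_iff_det_ne_zero).mpr (hVdet hr)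
  have hWpd : W.PosDef := by
    rw [hW]
    exact Matrix.PosDef.posSemidef_add hEpsd (hVpd.smul (by positivity))
  obtain ⟨G, hG⟩ := hWpd.posSemidef.exists_eq_transpose_mul_self
  have hdet : IsUnit G.det := by
    have h1 := hWpd.det_pos
    rw [hG, det_mul, det_transpose] at h1
    exact isUnit_iff_ne_zero.mpr fun h => by simp [h] at h1
  have hGi : G * G⁻¹ = 1 := mul_nonsing_inv G hdet
  have hiG : G⁻¹ * G = 1 := nonsing_inv_mul G hdet
  have hGiT : (G⁻¹)ᵀ * Gᵀ = 1 := by rw [← transpose_mul, hGi, transpose_one]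
  have hWone : (G⁻¹)ᵀ * W * G⁻¹ = 1 := by
    rw [hG, ← Matrix.mul_assoc, hGiT, Matrix.one_mul, hGi]
  refine ⟨fun i => (G⁻¹)ᵀ * A i * G⁻¹, fun j => G * B j * Gᵀ,
    fun i => (hA i).transpose_mul_mul_same_real _, fun j => (hB j).mul_mul_transpose_same_real _,
    fun i j => ?_, fun i => ?_, ?_, fun j => ?_⟩
  · calc ((G⁻¹)ᵀ * A i * G⁻¹ * (G * B j * Gᵀ)).trace
        = ((G⁻¹)ᵀ * (A i * (G⁻¹ * G) * B j * Gᵀ)).trace := by simp only [Matrix.mul_assoc]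
      _ = (A i * B j * (Gᵀ * (G⁻¹)ᵀ)).trace := by
          rw [hiG, Matrix.mul_one, trace_mul_comm, Matrix.mul_assoc]
      _ = _ := by rw [← transpose_mul, hiG, transpose_one, Matrix.mul_one]
  · have h1 : ((r : ℝ) ^ 2 • W - A i).PosSemidef := by
      have : (r : ℝ) ^ 2 • W - A i = (r : ℝ) ^ 2 • E + (V - A i) := by
        rw [hW, smul_add, smul_smul ((r : ℝ) ^ 2) ((r : ℝ) ^ 2)⁻¹, mul_inv_cancel₀ hr0.ne', one_smul,
          add_sub_assoc]
      rw [this]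
      exact (hEpsd.smul hr0.le).add (hVA i)
    have h2 := h1.transpose_mul_mul_same_real G⁻¹
    rwa [Matrix.mul_sub, Matrix.sub_mul, Matrix.mul_smul, Matrix.smul_mul, hWone] at h2
  · have h1 : (((r : ℝ) ^ 2)⁻¹ • V).PosSemidef := hV.smul (by positivity)
    have h2 := h1.transpose_mul_mul_same_real G⁻¹
    have h3 : ((r : ℝ) ^ 2)⁻¹ • V = W - E := by rw [hW, add_sub_cancel_left]
    rw [h3, Matrix.mul_sub, Matrix.sub_mul, hWone, hE, Matrix.mul_smul, Matrix.smul_mul,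
      Matrix.mul_sum, Matrix.sum_mul] at h2
    exact h2
  · have h1 : (G * B j * Gᵀ).trace = (W * B j).trace := by
      rw [trace_mul_comm, ← Matrix.mul_assoc, ← hG]
    rw [h1, hW, Matrix.add_mul, trace_add, hE, smul_mul, trace_smul, smul_mul, trace_smul,
      Matrix.sum_mul, trace_sum, smul_eq_mul, smul_eq_mul]
    have h2 : c * ∑ i, (A i * B j).trace ≤ 1 := by
      calc c * ∑ i, (A i * B j).trace ≤ c * ∑ i : ι, (1 : ℝ) := by
            gcongr with i _
            exact hAB i j
        _ = 1 := by
            have : (Fintype.card ι : ℝ) ≠ 0 := by simp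
            rw [hc]
            simp
    have h3 : ((r : ℝ) ^ 2)⁻¹ * (V * B j).trace ≤ 1 := by
      rw [inv_mul_le_iff₀ hr0, mul_one]
      exact hVB j
    linarith

end Matrices

/-! ### The test operator -/

section Operators

open Matrix

theorem trace_transpose_mul_transpose_mul_self_mul {r : ℕ} (G Q : Matrix (Fin r) (Fin r) ℝ) :
    (Qᵀ * (Gᵀ * G) * Q).trace = ∑ i, ∑ j, (∑ l, G i l * Q l j) ^ 2 := by
  have h : Qᵀ * (Gᵀ * G) * Q = (G * Q)ᵀ * (G * Q) := by
    rw [transpose_mul]; simp only [Matrix.mul_assoc]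
  rw [h, trace, Finset.sum_comm]
  refine Finset.sum_congr rfl fun j _ => ?_
  rw [diag_apply, Matrix.mul_apply]
  refine Finset.sum_congr rfl fun i _ => ?_
  rw [transpose_apply, Matrix.mul_apply, pow_two]

theorem trace_transpose_mul_self_eq_sum {r : ℕ} (Q : Matrix (Fin r) (Fin r) ℝ) :
    (Qᵀ * Q).trace = ∑ i, ∑ j, Q i j ^ 2 := by
  have h := trace_transpose_mul_transpose_mul_self_mul 1 Q
  rw [transpose_one, Matrix.one_mul, Matrix.mul_one] at h
  rw [h]
  refine Finset.sum_congr rfl fun i _ => Finset.sum_congr rfl fun j _ => ?_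
  rw [← Matrix.mul_apply, Matrix.one_mul]

theorem matrix_pow_mem_lowDegree {n r t : ℕ} {M : Cube n → Matrix (Fin r) (Fin r) ℝ}
    (hM : ∀ i j, (fun x => M x i j) ∈ lowDegree n t) (k : ℕ) (i j : Fin r) :
    (fun x => (M x ^ k) i j) ∈ lowDegree n (k * t) := by
  induction k generalizing i j with
  | zero =>
    simp only [pow_zero]
    exact const_mem_lowDegree _
  | succ k ih =>
    have h : (fun x => (M x ^ (k + 1)) i j)
        = ∑ l, (fun x => (M x ^ k) i l) * (fun x => M x l j) := by
      funext x
      simp [pow_succ, Matrix.mul_apply]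
    rw [h, Nat.succ_mul]
    exact Submodule.sum_mem _ fun l _ => mul_mem_lowDegree (ih i l) (hM l j)

theorem neg_le_expect_mul_trace {n m d r : ℕ} {D : Cube m → ℝ} (hD : IsPseudoDensity d D)
    (S : SubsetOfCard n m) {A : Matrix (Fin r) (Fin r) ℝ} (hA : A.PosSemidef) {a : ℝ}
    (hAa : (a • (1 : Matrix (Fin r) (Fin r) ℝ) - A).PosSemidef)
    (P : Cube n → Matrix (Fin r) (Fin r) ℝ) {θ : ℝ} (hθ : 0 < θ) :
    -(‖D‖ * (θ * 𝔼 x, ((P x)ᵀ * A * P x).trace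
        + (1 / θ + 1) * (a * ∑ i, ∑ j,
          𝔼 x, highPart (d / 2 + 1) S.1 (fun x => P x i j) x ^ 2)))
      ≤ 𝔼 x, D (cubeRestrict S x) * ((P x)ᵀ * A * P x).trace := by
  obtain ⟨G, rfl⟩ := hA.exists_eq_transpose_mul_self
  set Q : Cube n → Matrix (Fin r) (Fin r) ℝ := fun x =>
    Matrix.of fun i j => highPart (d / 2 + 1) S.1 (fun x => P x i j) x with hQ
  have hhigh : ∀ i j x, highPart (d / 2 + 1) S.1 (fun x => ∑ l, G i l * P x l j) x
      = ∑ l, G i l * Q x l j := fun i j x => by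
    rw [highPart_sum_mul]
    rfl
  have h1 : ∑ i, ∑ j, 𝔼 x, highPart (d / 2 + 1) S.1 (fun x => ∑ l, G i l * P x l j) x ^ 2
      ≤ a * ∑ i, ∑ j, 𝔼 x, highPart (d / 2 + 1) S.1 (fun x => P x i j) x ^ 2 := by
    simp_rw [← Finset.expect_sum_comm]
    rw [Finset.mul_expect]
    refine Finset.expect_le_expect fun x _ => ?_
    simp_rw [hhigh]
    rw [← trace_transpose_mul_transpose_mul_self_mul]
    have h2 := (hAa.transpose_mul_mul_same_real (Q x)).trace_nonneg
    rw [Matrix.mul_sub, Matrix.sub_mul, trace_sub, Matrix.mul_smul, Matrix.smul_mul, Matrix.mul_one,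
      trace_smul, smul_eq_mul, trace_transpose_mul_self_eq_sum, sub_nonneg] at h2
    exact h2
  simp_rw [trace_transpose_mul_transpose_mul_self_mul, Finset.mul_sum]
  simp_rw [Finset.expect_sum_comm]
  have h3 : ∑ i, ∑ j, -(‖D‖ * (θ * 𝔼 x, (∑ l, G i l * P x l j) ^ 2 + (1 / θ + 1) *
        𝔼 x, highPart (d / 2 + 1) S.1 (fun x => ∑ l, G i l * P x l j) x ^ 2))
      ≤ ∑ i, ∑ j, 𝔼 x, D (cubeRestrict S x) * (∑ l, G i l * P x l j) ^ 2 :=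
    Finset.sum_le_sum fun i _ => Finset.sum_le_sum fun j _ => neg_le_expect_mul_sq hD S _ hθ
  refine le_trans ?_ h3
  simp only [Finset.sum_neg_distrib, ← Finset.mul_sum, Finset.sum_add_distrib]
  gcongr

/-- The operator `Λ(x) = E_S D(x_S) A_S`. -/
noncomputable def testOperator {n m r : ℕ} (D : Cube m → ℝ)
    (A : SubsetOfCard n m → Matrix (Fin r) (Fin r) ℝ) (x : Cube n) : Matrix (Fin r) (Fin r) ℝ :=
  (Fintype.card (SubsetOfCard n m) : ℝ)⁻¹ • ∑ S, D (cubeRestrict S x) • A S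

theorem trace_testOperator_mul {n m r : ℕ} (D : Cube m → ℝ)
    (A : SubsetOfCard n m → Matrix (Fin r) (Fin r) ℝ) (x : Cube n)
    (B : Matrix (Fin r) (Fin r) ℝ) :
    (testOperator D A x * B).trace = 𝔼 S, D (cubeRestrict S x) * (A S * B).trace := by
  rw [Fintype.expect_eq_sum_div_card, testOperator, smul_mul, trace_smul, Matrix.sum_mul,
    trace_sum, smul_eq_mul, div_eq_inv_mul]
  simp

theorem testOperator_mem_lowDegree {n m r : ℕ} (D : Cube m → ℝ)
    (A : SubsetOfCard n m → Matrix (Fin r) (Fin r) ℝ) (i j : Fin r) :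
    (fun x => testOperator D A x i j) ∈ lowDegree n m := by
  have h : (fun x => testOperator D A x i j) = (Fintype.card (SubsetOfCard n m) : ℝ)⁻¹ •
      ∑ S, A S i j • fun x => D (cubeRestrict S x) := by
    funext x
    simp [testOperator, Matrix.sum_apply, mul_comm]
  rw [h]
  exact Submodule.smul_mem _ _ (Submodule.sum_mem _ fun S _ =>
    Submodule.smul_mem _ _ (comp_cubeRestrict_mem_lowDegree S D))

theorem posSemidef_norm_smul_one_sub_testOperator {n m r : ℕ} (D : Cube m → ℝ)
    {A : SubsetOfCard n m → Matrix (Fin r) (Fin r) ℝ} (hA : ∀ S, (A S).PosSemidef)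
    (hAE : (1 - (Fintype.card (SubsetOfCard n m) : ℝ)⁻¹ • ∑ S, A S).PosSemidef) (x : Cube n) :
    (‖D‖ • (1 : Matrix (Fin r) (Fin r) ℝ) - testOperator D A x).PosSemidef := by
  have h : ‖D‖ • (1 : Matrix (Fin r) (Fin r) ℝ) - testOperator D A x
      = ‖D‖ • (1 - (Fintype.card (SubsetOfCard n m) : ℝ)⁻¹ • ∑ S, A S)
        + (Fintype.card (SubsetOfCard n m) : ℝ)⁻¹ •
          ∑ S, (‖D‖ - D (cubeRestrict S x)) • A S := by
    simp only [testOperator, sub_smul, Finset.sum_sub_distrib, ← Finset.smul_sum, smul_sub]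
    rw [smul_comm ‖D‖ (Fintype.card (SubsetOfCard n m) : ℝ)⁻¹]
    abel
  rw [h]
  refine (hAE.smul (norm_nonneg D)).add (Matrix.PosSemidef.smul ?_ (by positivity))
  refine posSemidef_sum _ fun S _ => (hA S).smul ?_
  exact sub_nonneg.mpr ((le_abs_self _).trans (abs_le_norm_cubeRestrict D S x))

theorem neg_le_expect_trace_testOperator {n m d r t : ℕ} (hn : 0 < n) (hmn : m ≤ n)
    {D : Cube m → ℝ} (hD : IsPseudoDensity d D)
    {A : SubsetOfCard n m → Matrix (Fin r) (Fin r) ℝ} (hA : ∀ S, (A S).PosSemidef) {a : ℝ}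
    (ha : 0 ≤ a)
    (hAa : ∀ S, (a • (1 : Matrix (Fin r) (Fin r) ℝ) - A S).PosSemidef)
    (hAE : (1 - (Fintype.card (SubsetOfCard n m) : ℝ)⁻¹ • ∑ S, A S).PosSemidef)
    {P : Cube n → Matrix (Fin r) (Fin r) ℝ} (hPsymm : ∀ x, (P x)ᵀ = P x)
    (hP : ∀ i j, (fun x => P x i j) ∈ lowDegree n t) {θ : ℝ} (hθ : 0 < θ) :
    -(‖D‖ * (θ + (1 / θ + 1) * (a * ((t : ℝ) * m / n) ^ (d / 2 + 1)))
        * 𝔼 x, (P x * P x).trace)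
      ≤ 𝔼 x, (testOperator D A x * (P x * P x)).trace := by
  have hcyc : ∀ S x, (A S * (P x * P x)).trace = ((P x)ᵀ * A S * P x).trace := by
    intro S x
    rw [hPsymm, ← Matrix.mul_assoc, trace_mul_comm, Matrix.mul_assoc]
  have h1 : 𝔼 x, (testOperator D A x * (P x * P x)).trace
      = 𝔼 S, 𝔼 x, D (cubeRestrict S x) * ((P x)ᵀ * A S * P x).trace := by
    simp_rw [trace_testOperator_mul, hcyc]
    rw [Finset.expect_comm]
  rw [h1]
  refine le_trans ?_ (Finset.expect_le_expect fun S _ =>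
    neg_le_expect_mul_trace hD S (hA S) (hAa S) P hθ)
  rw [Finset.expect_neg_distrib, neg_le_neg_iff, ← Finset.mul_expect, mul_assoc]
  refine mul_le_mul_of_nonneg_left ?_ (norm_nonneg D)
  rw [Finset.expect_add_distrib, ← Finset.mul_expect, ← Finset.mul_expect, ← Finset.mul_expect,
    add_mul θ]
  have h2 : 𝔼 S, 𝔼 x, ((P x)ᵀ * A S * P x).trace ≤ 𝔼 x, (P x * P x).trace := by
    rw [Finset.expect_comm]
    refine Finset.expect_le_expect fun x _ => ?_
    have h3 := (hAE.transpose_mul_mul_same_real (P x)).trace_nonneg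
    rw [Matrix.mul_sub, Matrix.sub_mul, trace_sub, Matrix.mul_one, Matrix.mul_smul, Matrix.smul_mul,
      trace_smul, Matrix.mul_sum, Matrix.sum_mul, trace_sum, smul_eq_mul, ← div_eq_inv_mul,
      ← Fintype.expect_eq_sum_div_card, sub_nonneg, hPsymm] at h3
    simpa only [hPsymm] using h3
  have h4 : 𝔼 S : SubsetOfCard n m, ∑ i, ∑ j,
      𝔼 x, highPart (d / 2 + 1) S.1 (fun x => P x i j) x ^ 2
      ≤ ((t : ℝ) * m / n) ^ (d / 2 + 1) * 𝔼 x, (P x * P x).trace := by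
    have h5 : 𝔼 x, (P x * P x).trace = ∑ i, ∑ j, 𝔼 x, P x i j ^ 2 := by
      simp_rw [← Finset.expect_sum_comm, ← trace_transpose_mul_self_eq_sum, hPsymm]
    rw [h5]
    simp_rw [Finset.expect_sum_comm, Finset.mul_sum]
    exact Finset.sum_le_sum fun i _ => Finset.sum_le_sum fun j _ =>
      expect_highPart_sq_le hn hmn (hP i j)
  have h6 : 0 ≤ 1 / θ + 1 := by positivity
  calc _ ≤ θ * 𝔼 x, (P x * P x).trace + (1 / θ + 1) *
        (a * (((t : ℝ) * m / n) ^ (d / 2 + 1) * 𝔼 x, (P x * P x).trace)) := by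
        gcongr
    _ = _ := by ring

theorem Matrix.PosSemidef.exists_spectral_weights {r : ℕ} {M B : Matrix (Fin r) (Fin r) ℝ}
    (hM : M.PosSemidef) (hB : B.PosSemidef) :
    ∃ μ w : Fin r → ℝ, (∀ i, 0 ≤ μ i) ∧ (∀ i, 0 ≤ w i) ∧ (∀ i, w i ≤ B.trace) ∧
      ∀ k : ℕ, (M ^ k).trace = ∑ i, μ i ^ k ∧ (M ^ k * B).trace = ∑ i, μ i ^ k * w i := by
  obtain ⟨U, μ, h1, h2, hμ, h⟩ := hM.exists_eq_mul_diagonal_mul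
  have hB' := hB.transpose_mul_mul_same_real U
  have hw0 : ∀ i, 0 ≤ (Uᵀ * B * U) i i := fun i => hB'.diag_nonneg
  have htr : (Uᵀ * B * U).trace = B.trace := by
    rw [trace_mul_comm, ← Matrix.mul_assoc, h2, Matrix.one_mul]
  have hpow : ∀ k : ℕ, M ^ k = U * diagonal (fun i => μ i ^ k) * Uᵀ := by
    intro k
    induction k with
    | zero => simp [h2]
    | succ k ih =>
      rw [pow_succ, ih, h]
      calc _ = U * diagonal (fun i => μ i ^ k) * (Uᵀ * U) * diagonal μ * Uᵀ := by
            simp only [Matrix.mul_assoc]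
        _ = _ := by
            rw [h1, Matrix.mul_one, Matrix.mul_assoc U, diagonal_mul_diagonal]
            simp only [pow_succ]
  refine ⟨μ, fun i => (Uᵀ * B * U) i i, hμ, hw0, fun i => ?_, fun k => ⟨?_, ?_⟩⟩
  · rw [← htr]
    exact Finset.single_le_sum (f := fun i => (Uᵀ * B * U) i i) (fun j _ => hw0 j)
      (Finset.mem_univ i)
  · rw [hpow, trace_mul_comm, ← Matrix.mul_assoc, h1, Matrix.one_mul, trace_diagonal]
  · rw [hpow]
    have : (U * diagonal (fun i => μ i ^ k) * Uᵀ * B).trace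
        = (diagonal (fun i => μ i ^ k) * (Uᵀ * B * U)).trace := by
      rw [Matrix.mul_assoc, Matrix.mul_assoc, trace_mul_comm]
      simp only [Matrix.mul_assoc]
    rw [this, trace]
    exact Finset.sum_congr rfl fun i _ => by rw [diag_apply, diagonal_mul]

end Operators

/-! ### Power means -/

theorem succ_mul_pow_mul_le (q : ℕ) {a b : ℝ} (ha : 0 ≤ a) (hb : 0 ≤ b) :
    ((q : ℝ) + 1) * (a ^ q * b) ≤ q * a ^ (q + 1) + b ^ (q + 1) := by
  induction q with
  | zero => simp
  | succ q ih =>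
    have h1 := mul_le_mul_of_nonneg_left ih hb
    have h2 : 0 ≤ ((q : ℝ) + 1) * (a ^ q * (a - b) ^ 2) := by positivity
    push_cast
    have e1 : a ^ (q + 1) = a ^ q * a := pow_succ _ _
    have e2 : a ^ (q + 1 + 1) = a ^ q * a * a := by rw [pow_succ, pow_succ]
    have e3 : b ^ (q + 1 + 1) = b ^ (q + 1) * b := pow_succ _ _
    rw [e1] at h1
    rw [e1, e2, e3]
    nlinarith

theorem sum_pow_le_card_mul_pow {ι : Type*} [Fintype ι] {μ : ι → ℝ} (hμ : ∀ i, 0 ≤ μ i) {q : ℕ}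
    {ρ : ℝ} (hρ : 0 < ρ) (h : ∑ i, μ i ^ (q + 1) ≤ ρ * ∑ i, μ i ^ q) :
    ∑ i, μ i ^ q ≤ Fintype.card ι * ρ ^ q := by
  have h1 : ∑ i, ((q : ℝ) + 1) * (μ i ^ q * ρ) ≤ ∑ i, (q * μ i ^ (q + 1) + ρ ^ (q + 1)) :=
    Finset.sum_le_sum fun i _ => succ_mul_pow_mul_le q (hμ i) hρ.le
  rw [← Finset.mul_sum, ← Finset.sum_mul, Finset.sum_add_distrib, ← Finset.mul_sum,
    Finset.sum_const, Finset.card_univ, nsmul_eq_mul] at h1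
  have h2 := mul_le_mul_of_nonneg_left h (Nat.cast_nonneg (α := ℝ) q)
  refine le_of_mul_le_mul_right ?_ hρ
  rw [pow_succ] at h1
  nlinarith

theorem sum_mul_le_of_sum_pow_succ_le {ι : Type*} [Fintype ι] {μ w : ι → ℝ} (hμ : ∀ i, 0 ≤ μ i)
    (hw : ∀ i, 0 ≤ w i) {b : ℝ} (hwb : ∀ i, w i ≤ b) (hW : 0 < ∑ i, w i) {q : ℕ} (hq : q ≠ 0)
    {ρ c : ℝ} (hρ : 0 < ρ) (hc : 0 ≤ c) (h : ∑ i, μ i ^ (q + 1) ≤ ρ * ∑ i, μ i ^ q)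
    (hcq : b * Fintype.card ι ≤ c ^ q * ∑ i, w i) :
    ∑ i, μ i * w i ≤ c * ρ * ∑ i, w i := by
  set W := ∑ i, w i with hWdef
  have h1 := Real.pow_arith_mean_le_arith_mean_pow Finset.univ (fun i => w i / W) μ
    (fun i _ => div_nonneg (hw i) hW.le)
    (by rw [← Finset.sum_div]; exact div_self hW.ne') (fun i _ => hμ i) q
  have h2 : ∑ i, w i / W * μ i ^ q ≤ (c * ρ) ^ q := by
    calc ∑ i, w i / W * μ i ^ q ≤ ∑ i, b / W * μ i ^ q := by
          refine Finset.sum_le_sum fun i _ => ?_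
          have := hμ i
          gcongr
          exact hwb i
      _ = b / W * ∑ i, μ i ^ q := by rw [Finset.mul_sum]
      _ ≤ b / W * (Fintype.card ι * ρ ^ q) := by
          have hne : (Finset.univ : Finset ι).Nonempty := by
            by_contra hne
            rw [Finset.not_nonempty_iff_eq_empty] at hne
            simp [hWdef, hne] at hW
          have hb : 0 ≤ b := (hw hne.choose).trans (hwb _)
          gcongr
          exact sum_pow_le_card_mul_pow hμ hρ h
      _ = (b * Fintype.card ι) / W * ρ ^ q := by ring
      _ ≤ c ^ q * ρ ^ q := by
          gcongr
          rwa [div_le_iff₀ hW]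
      _ = (c * ρ) ^ q := (mul_pow _ _ _).symm
  have h3 : ∑ i, w i / W * μ i ≤ c * ρ :=
    le_of_pow_le_pow_left₀ hq (by positivity) (h1.trans h2)
  have h4 : ∑ i, w i / W * μ i = (∑ i, μ i * w i) / W := by
    rw [Finset.sum_div]
    exact Finset.sum_congr rfl fun i _ => by ring
  rwa [h4, div_le_iff₀ hW] at h3

/-! ### The lower bound -/

section Main

open Matrix

theorem one_le_norm_of_isPseudoDensity {m d : ℕ} {D : Cube m → ℝ} (hD : IsPseudoDensity d D) :
    1 ≤ ‖D‖ := by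
  rw [← hD.1]
  calc 𝔼 x, D x ≤ 𝔼 _x : Cube m, ‖D‖ :=
        Finset.expect_le_expect fun x _ => (le_abs_self _).trans (norm_le_pi_norm D x)
    _ = ‖D‖ := Fintype.expect_const _

theorem neg_le_expect_trace_testOperator_mul {n m d r k : ℕ} (hn : 0 < n) (hmn : m ≤ n)
    {D : Cube m → ℝ} (hD : IsPseudoDensity d D)
    {A : SubsetOfCard n m → Matrix (Fin r) (Fin r) ℝ} (hA : ∀ S, (A S).PosSemidef)
    (hAa : ∀ S, ((r : ℝ) ^ 2 • (1 : Matrix (Fin r) (Fin r) ℝ) - A S).PosSemidef)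
    (hAE : (1 - (Fintype.card (SubsetOfCard n m) : ℝ)⁻¹ • ∑ S, A S).PosSemidef)
    {B : Cube n → Matrix (Fin r) (Fin r) ℝ} (hB : ∀ x, (B x).PosSemidef)
    (hBtr : ∀ x, (B x).trace ≤ 2) {ν : ℝ} (hν : 0 < ν) (hνB : ν ≤ 𝔼 x, (B x).trace)
    {ε : ℝ} (hε : 0 < ε) (hε1 : ε ≤ 1) (hk : k ≠ 0)
    (h1 : 144 * ‖D‖ ^ 2 * ((r : ℝ) ^ 2 * (((k * m : ℕ) : ℝ) * m / n) ^ (d / 2 + 1)) ≤ ε ^ 2)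
    (h2 : 2 * r ≤ (1 + ε / (8 * ‖D‖)) ^ (2 * k) * ν) :
    -ε ≤ 𝔼 x, (testOperator D A x * B x).trace := by
  have hT := one_le_norm_of_isPseudoDensity hD
  set T := ‖D‖
  have hT0 : 0 < T := by linarith
  set M : Cube n → Matrix (Fin r) (Fin r) ℝ :=
    fun x => T • (1 : Matrix (Fin r) (Fin r) ℝ) - testOperator D A x with hMdef
  have hM : ∀ x, (M x).PosSemidef := posSemidef_norm_smul_one_sub_testOperator D hA hAE
  have hMdeg : ∀ i j, (fun x => M x i j) ∈ lowDegree n m := fun i j =>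
    Submodule.sub_mem _ (const_mem_lowDegree ((T • (1 : Matrix (Fin r) (Fin r) ℝ)) i j))
      (testOperator_mem_lowDegree D A i j)
  have hMmul : ∀ x (X : Matrix (Fin r) (Fin r) ℝ),
      (M x * X).trace = T * X.trace - (testOperator D A x * X).trace := fun x X => by
    simp only [hMdef, Matrix.sub_mul, trace_sub, Matrix.smul_mul, Matrix.one_mul, trace_smul,
      smul_eq_mul]
  set ρ := T + ε / 4 with hρ
  have hlow := neg_le_expect_trace_testOperator hn hmn hD hA (sq_nonneg (r : ℝ)) hAa hAE
    (P := fun x => M x ^ k) (fun x => ((hM x).pow k).transpose_eq_real)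
    (matrix_pow_mem_lowDegree hMdeg k) (θ := ε / (12 * T)) (by positivity)
  simp only [← pow_add] at hlow
  have hYnn : 0 ≤ 𝔼 x, (M x ^ (k + k)).trace :=
    Finset.expect_nonneg fun x _ => ((hM x).pow _).trace_nonneg
  have hcoef : T * (ε / (12 * T) + (1 / (ε / (12 * T)) + 1) *
      ((r : ℝ) ^ 2 * (((k * m : ℕ) : ℝ) * m / n) ^ (d / 2 + 1))) ≤ ε / 4 := by
    set κ := (r : ℝ) ^ 2 * (((k * m : ℕ) : ℝ) * m / n) ^ (d / 2 + 1)
    have hκ0 : 0 ≤ κ := by positivity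
    have e : T * (ε / (12 * T) + (1 / (ε / (12 * T)) + 1) * κ)
        = ε / 12 + 12 * T ^ 2 * κ / ε + T * κ := by
      field_simp
      ring
    have e1 : 12 * T ^ 2 * κ / ε ≤ ε / 12 := by
      rw [div_le_div_iff₀ hε (by norm_num)]
      nlinarith
    have e2 : T * κ ≤ ε / 12 := by
      have : T * κ ≤ T ^ 2 * κ := by
        refine mul_le_mul_of_nonneg_right ?_ hκ0
        nlinarith
      nlinarith
    rw [e]
    linarith
  have hmom : 𝔼 x, (M x ^ (2 * k + 1)).trace ≤ ρ * 𝔼 x, (M x ^ (2 * k)).trace := by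
    simp_rw [pow_succ', hMmul]
    rw [Finset.expect_sub_distrib, ← Finset.mul_expect, two_mul]
    have := mul_le_mul_of_nonneg_right hcoef hYnn
    rw [hρ, add_mul]
    linarith
  choose μ w hμ hw hwtr hspec using fun x => (hM x).exists_spectral_weights (hB x)
  have hcard : (0 : ℝ) < Fintype.card (Cube n) := by exact_mod_cast Fintype.card_pos
  have hsum : ∀ F : Cube n → ℝ, ∑ x, F x = Fintype.card (Cube n) * 𝔼 x, F x := fun F => by
    rw [Fintype.card_mul_expect]
  have hW : ∑ p : Cube n × Fin r, w p.1 p.2 = Fintype.card (Cube n) * 𝔼 x, (B x).trace := by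
    rw [Fintype.sum_prod_type, ← hsum]
    refine Finset.sum_congr rfl fun x _ => ?_
    simpa using ((hspec x 0).2).symm
  have hY : ∀ q, ∑ p : Cube n × Fin r, μ p.1 p.2 ^ q
      = Fintype.card (Cube n) * 𝔼 x, (M x ^ q).trace := by
    intro q
    rw [Fintype.sum_prod_type, ← hsum]
    exact Finset.sum_congr rfl fun x _ => ((hspec x q).1).symm
  have hMB : ∑ p : Cube n × Fin r, μ p.1 p.2 * w p.1 p.2
      = Fintype.card (Cube n) * 𝔼 x, (M x * B x).trace := by
    rw [Fintype.sum_prod_type, ← hsum]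
    refine Finset.sum_congr rfl fun x _ => ?_
    simpa using ((hspec x 1).2).symm
  set β := 𝔼 x, (B x).trace with hβ
  have hβ0 : 0 < β := hν.trans_le hνB
  have hβ2 : β ≤ 2 := by
    calc β ≤ 𝔼 _x : Cube n, (2 : ℝ) := Finset.expect_le_expect fun x _ => hBtr x
      _ = 2 := Fintype.expect_const _
  set c := 1 + ε / (8 * T) with hc
  have hc0 : 0 ≤ c := by positivity
  have key := sum_mul_le_of_sum_pow_succ_le (ι := Cube n × Fin r) (μ := fun p => μ p.1 p.2)
    (w := fun p => w p.1 p.2) (fun p => hμ _ _) (fun p => hw _ _) (b := 2)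
    (fun p => (hwtr _ _).trans (hBtr _)) (by rw [hW]; positivity) (q := 2 * k) (by omega)
    (ρ := ρ) (c := c) (by positivity) hc0
    (by
      rw [hY, hY]
      calc _ ≤ Fintype.card (Cube n) * (ρ * 𝔼 x, (M x ^ (2 * k)).trace) := by gcongr
        _ = _ := by ring)
    (by
      rw [hW, Fintype.card_prod, Fintype.card_fin, Nat.cast_mul]
      calc (2 : ℝ) * (Fintype.card (Cube n) * r) = Fintype.card (Cube n) * (2 * r) := by ring
        _ ≤ Fintype.card (Cube n) * (c ^ (2 * k) * β) := by
            refine mul_le_mul_of_nonneg_left (h2.trans ?_) hcard.le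
            exact mul_le_mul_of_nonneg_left hνB (by positivity)
        _ = _ := by ring)
  rw [hMB, hW] at key
  have key2 : 𝔼 x, (M x * B x).trace ≤ c * ρ * β := by
    refine le_of_mul_le_mul_left ?_ hcard
    linarith
  simp_rw [hMmul] at key2
  rw [Finset.expect_sub_distrib, ← Finset.mul_expect, ← hβ] at key2
  have hcρ : c * ρ ≤ T + ε / 2 := by
    have e : c * ρ = T + ε / 4 + ε / 8 + ε / 32 * (ε / T) := by
      rw [hc, hρ]
      field_simp
      ring
    have e1 : ε / T ≤ 1 := by
      rw [div_le_one hT0]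
      linarith
    rw [e]
    nlinarith
  nlinarith

theorem exists_degree_bound {n m d r : ℕ} (hm : 1 ≤ m) (hd : 1 ≤ d) (hn : 2 ≤ n) (hr : r ≠ 0)
    {ε T ν : ℝ} (hε : 0 < ε) (hε1 : ε ≤ 1) (hT : 1 ≤ T) (hν : 0 < ν) (hν1 : ν ≤ 1)
    (h : (r : ℝ) ^ 2 / ν ≤ (1 / 10 ^ 6 * ε / ((d : ℝ) * (m : ℝ) ^ 2 * T)) ^ ((d : ℝ) / 2)
      * (ε / T) ^ 3 * ((n : ℝ) / Real.log (n : ℝ)) ^ ((d : ℝ) / 2)) :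
    ∃ k : ℕ, k ≠ 0 ∧
      144 * T ^ 2 * ((r : ℝ) ^ 2 * (((k * m : ℕ) : ℝ) * m / n) ^ (d / 2 + 1)) ≤ ε ^ 2 ∧
      2 * r ≤ (1 + ε / (8 * T)) ^ (2 * k) * ν := by
  have hT0 : 0 < T := by linarith
  have hmR : (1 : ℝ) ≤ m := by exact_mod_cast hm
  have hdR : (1 : ℝ) ≤ d := by exact_mod_cast hd
  have hnR : (2 : ℝ) ≤ n := by exact_mod_cast hn
  have hrR : (1 : ℝ) ≤ r := by exact_mod_cast Nat.one_le_iff_ne_zero.mpr hr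
  set l := Real.log n with hl
  have hl2 : Real.log 2 ≤ l := Real.log_le_log (by norm_num) hnR
  have hlog2 := Real.log_two_gt_d9
  have hl0 : 1 / 2 ≤ l := by linarith
  have hl00 : 0 < l := by linarith
  set z : ℝ := 1 / 10 ^ 6 * ε / ((d : ℝ) * (m : ℝ) ^ 2 * T) * (n / l) with hz
  have hz0 : 0 < z := by positivity
  have hd2 : 0 < (d : ℝ) / 2 := by positivity
  have hεT : ε / T ≤ 1 := by rw [div_le_one hT0]; linarith
  have hεT0 : 0 < ε / T := by positivity
  have hmain : (r : ℝ) ^ 2 / ν ≤ z ^ ((d : ℝ) / 2) * (ε / T) ^ 3 := by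
    refine h.trans (le_of_eq ?_)
    rw [hz, Real.mul_rpow (by positivity) (by positivity)]
    ring
  have hr2ν : (r : ℝ) ^ 2 ≤ (r : ℝ) ^ 2 / ν := by
    rw [le_div_iff₀ hν]
    exact mul_le_of_le_one_right (sq_nonneg _) hν1
  have hzd : (r : ℝ) ^ 2 / ν ≤ z ^ ((d : ℝ) / 2) := by
    refine hmain.trans (mul_le_of_le_one_right (by positivity) (pow_le_one₀ hεT0.le hεT))
  have hz1 : 1 ≤ z := by
    by_contra hlt
    have h1 := Real.rpow_lt_one hz0.le (not_le.mp hlt) hd2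
    have h2 : 1 ≤ (r : ℝ) ^ 2 := one_le_pow₀ hrR
    linarith
  have hzn : z ≤ n := by
    have e1 : 1 / 10 ^ 6 * ε / ((d : ℝ) * (m : ℝ) ^ 2 * T) ≤ 1 / 10 ^ 6 := by
      rw [div_le_iff₀ (by positivity)]
      have : 1 ≤ (d : ℝ) * (m : ℝ) ^ 2 * T :=
        one_le_mul_of_one_le_of_one_le (one_le_mul_of_one_le_of_one_le hdR (one_le_pow₀ hmR)) hT
      linarith
    have e2 : (n : ℝ) / l ≤ 2 * n := by
      rw [div_le_iff₀ hl00]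
      have : 2 * (n : ℝ) * (1 / 2) ≤ 2 * n * l := by gcongr
      linarith
    calc z ≤ 1 / 10 ^ 6 * (2 * n) := by
          rw [hz]
          gcongr
      _ ≤ n := by linarith
  set K : ℝ := 2 * r / ν with hK
  have hK0 : 0 < K := by positivity
  have hK1 : 1 < K := by
    rw [hK, lt_div_iff₀ hν]
    linarith
  have hlogK0 : 0 < Real.log K := Real.log_pos hK1
  have hlogK : Real.log K ≤ 3 / 2 * d * l := by
    have e1 : K ≤ 2 * (n : ℝ) ^ ((d : ℝ) / 2) := by
      calc K ≤ 2 * ((r : ℝ) ^ 2 / ν) := by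
            rw [hK, mul_div_assoc]
            gcongr
            exact le_self_pow₀ hrR two_ne_zero
        _ ≤ 2 * z ^ ((d : ℝ) / 2) := by gcongr
        _ ≤ 2 * (n : ℝ) ^ ((d : ℝ) / 2) := by gcongr
    have e2 := Real.log_le_log hK0 e1
    rw [Real.log_mul (by norm_num) (by positivity), Real.log_rpow (by linarith)] at e2
    have e3 : 1 * l ≤ d * l := by gcongr
    linarith
  set k : ℕ := ⌈8 * T * Real.log K / ε⌉₊ with hk
  have hkpos : 0 < 8 * T * Real.log K / ε := by positivity
  have hk0 : k ≠ 0 := (Nat.ceil_pos.mpr hkpos).ne'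
  have hk1 : 8 * T * Real.log K / ε ≤ k := Nat.le_ceil _
  have hk2 : (k : ℝ) ≤ 14 * T * d * l / ε := by
    have e1 : (k : ℝ) < 8 * T * Real.log K / ε + 1 := Nat.ceil_lt_add_one hkpos.le
    have e2 : 8 * T * Real.log K / ε ≤ 12 * T * d * l / ε := by
      rw [div_le_div_iff_of_pos_right hε]
      have : 8 * T * Real.log K ≤ 8 * T * (3 / 2 * d * l) := by gcongr
      linarith
    have e3 : 1 ≤ 2 * T * d * l / ε := by
      rw [le_div_iff₀ hε]
      have h1 : 1 ≤ T * d := one_le_mul_of_one_le_of_one_le hT hdR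
      have h2 : 1 * (1 / 2) ≤ T * d * l := by gcongr
      linarith
    have e4 : 14 * T * d * l / ε = 12 * T * d * l / ε + 2 * T * d * l / ε := by ring
    linarith
  refine ⟨k, hk0, ?_, ?_⟩
  · set y : ℝ := ((k * m : ℕ) : ℝ) * m / n with hy
    have hkR : (0 : ℝ) < k := by exact_mod_cast Nat.pos_of_ne_zero hk0
    have hy0 : 0 < y := by
      rw [hy]
      push_cast
      positivity
    have hyz : y * z ≤ (1 / 144) ^ 2 := by
      have e : y * z = k * (ε / (T * d * l)) / 10 ^ 6 := by
        rw [hy, hz]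
        push_cast
        field_simp
      have e2 : k * (ε / (T * d * l)) ≤ 14 := by
        calc k * (ε / (T * d * l)) ≤ 14 * T * d * l / ε * (ε / (T * d * l)) := by gcongr
          _ = 14 := by field_simp
      rw [e]
      linarith
    have hy1 : y ≤ 1 := by
      have : y * 1 ≤ y * z := by gcongr
      linarith
    have hys : y ^ (d / 2 + 1) ≤ y ^ ((d : ℝ) / 2) := by
      rw [← Real.rpow_natCast]
      refine Real.rpow_le_rpow_of_exponent_ge hy0 hy1 ?_
      have : d ≤ 2 * (d / 2 + 1) := by omega
      have : (d : ℝ) ≤ 2 * ((d / 2 + 1 : ℕ) : ℝ) := by exact_mod_cast this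
      linarith
    have hyzd : (y * z) ^ ((d : ℝ) / 2) ≤ 1 / 144 := by
      calc (y * z) ^ ((d : ℝ) / 2) ≤ ((1 / 144 : ℝ) ^ 2) ^ ((d : ℝ) / 2) := by gcongr
        _ = (1 / 144 : ℝ) ^ d := by
            rw [← Real.rpow_natCast, ← Real.rpow_mul (by norm_num), ← Real.rpow_natCast]
            congr 1
            push_cast
            ring
        _ ≤ 1 / 144 := pow_le_of_le_one (by norm_num) (by norm_num) (by omega)
    calc 144 * T ^ 2 * ((r : ℝ) ^ 2 * y ^ (d / 2 + 1))
        ≤ 144 * T ^ 2 * ((z ^ ((d : ℝ) / 2) * (ε / T) ^ 3) * y ^ ((d : ℝ) / 2)) := by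
          gcongr
          exact hr2ν.trans hmain
      _ = 144 * ε ^ 2 * ((ε / T) * (y * z) ^ ((d : ℝ) / 2)) := by
          rw [Real.mul_rpow hy0.le hz0.le]
          field_simp
      _ ≤ 144 * ε ^ 2 * (1 * (1 / 144)) := by gcongr
      _ = ε ^ 2 := by ring
  · rw [← div_le_iff₀ hν, ← hK]
    set t := ε / (8 * T) with ht
    have ht0 : 0 < t := by positivity
    have ht1 : t ≤ 1 := by
      rw [ht, div_le_one (by positivity)]
      linarith
    have e1 : t / 2 ≤ Real.log (1 + t) := by
      refine le_trans ?_ (Real.one_sub_inv_le_log_of_pos (by positivity))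
      have : 1 - (1 + t)⁻¹ = t / (1 + t) := by field_simp; ring
      rw [this]
      gcongr
      linarith
    rw [← Real.log_le_log_iff hK0 (by positivity), Real.log_pow]
    have e2 : Real.log K ≤ k * t := by
      rw [div_le_iff₀ hε] at hk1
      rw [ht, ← mul_div_assoc, le_div_iff₀ (by positivity)]
      linarith
    have e3 : (k : ℝ) * (t / 2) ≤ k * Real.log (1 + t) := by gcongr
    push_cast
    linarith

theorem entryAverage_pos {ι κ : Type} [Fintype ι] [Fintype κ] {N : ι → κ → ℝ}
    (hN : ∀ i j, 0 ≤ N i j) (hN0 : N ≠ 0) : 0 < entryAverage N := by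
  obtain ⟨i, hi⟩ := Function.ne_iff.mp hN0
  obtain ⟨j, hj⟩ := Function.ne_iff.mp hi
  have hpos : 0 < N i j := lt_of_le_of_ne (hN i j) (Ne.symm hj)
  refine Finset.expect_pos' (fun i _ => Finset.expect_nonneg fun j _ => hN i j)
    ⟨i, Finset.mem_univ i, ?_⟩
  exact Finset.expect_pos' (fun j _ => hN i j) ⟨j, Finset.mem_univ j, hpos⟩

end Main

/-- The norms `‖D‖` and `‖N‖` are Mathlib's sup norms on functions on a finite set, that is,
the maximal absolute value of an entry. -/
theorem mainTheorem6 :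
    ∃ C : ℝ, 0 < C ∧
      ∀ m d : ℕ, 1 ≤ m → 1 ≤ d →
      ∀ ε : ℝ, 0 < ε → ε ≤ 1 →
      ∀ D : Cube m → ℝ, IsPseudoDensity d D →
      ∃ α : ℝ, 0 < α ∧
        α = (C * ε / ((d : ℝ) * (m : ℝ) ^ 2 * ‖D‖)) ^ ((d : ℝ) / 2) * (ε / ‖D‖) ^ 3 ∧
        ∀ n : ℕ, 2 * m ≤ n →
        ∀ N : SubsetOfCard n m → Cube n → ℝ,
          (∀ S x, 0 ≤ N S x) →
          ‖N‖ ≤ 1 →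
          (psdRank N : ℝ) ^ 2 / entryAverage N
            ≤ α * ((n : ℝ) / Real.log (n : ℝ)) ^ ((d : ℝ) / 2) →
          -ε ≤ separatingFunctional D N := by
  refine ⟨1 / 10 ^ 6, by norm_num, fun m d hm hd ε hε hε1 D hD => ⟨_, ?_, rfl, ?_⟩⟩
  · have hT := one_le_norm_of_isPseudoDensity hD
    positivity
  intro n hmn N hN hN1 hrank
  have hT := one_le_norm_of_isPseudoDensity hD
  by_cases hN0 : N = 0
  · subst hN0
    simp [separatingFunctional, hε.le]
  have hle : ∀ S x, N S x ≤ 1 := fun S x =>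
    (le_abs_self _).trans (((norm_le_pi_norm (N S) x).trans (norm_le_pi_norm N S)).trans hN1)
  have hν := entryAverage_pos hN hN0
  have hcard : Fintype.card (SubsetOfCard n m) ≠ 0 := by
    rw [card_subsetOfCard]
    exact (Nat.choose_pos (by omega)).ne'
  have : Nonempty (SubsetOfCard n m) := Fintype.card_pos_iff.mp (Nat.pos_of_ne_zero hcard)
  have hν1 : entryAverage N ≤ 1 := by
    calc entryAverage N ≤ 𝔼 _S : SubsetOfCard n m, 𝔼 _x : Cube n, (1 : ℝ) :=
          Finset.expect_le_expect fun S _ => Finset.expect_le_expect fun x _ => hle S x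
      _ = 1 := by simp
  obtain ⟨A₀, B₀, hA₀, hB₀, hAB₀⟩ := hasPsdFactorization_psdRank N hN
  have hr : psdRank N ≠ 0 := by
    intro h0
    refine hN0 (funext fun S => funext fun x => ?_)
    have : IsEmpty (Fin (psdRank N)) := by rw [h0]; infer_instance
    rw [hAB₀, Matrix.trace]
    simp
  obtain ⟨A, B, hA, hB, hAB, hAa, hAE, hBtr⟩ := exists_rescaled_factorization hr A₀ B₀ hA₀ hB₀
    fun S x => (hAB₀ S x).symm.trans_le (hle S x)
  have hNAB : ∀ S x, N S x = (A S * B x).trace := fun S x => (hAB₀ S x).trans (hAB S x).symm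
  obtain ⟨k, hk, h1, h2⟩ := exists_degree_bound hm hd (by omega : 2 ≤ n) hr hε hε1 hT hν hν1 hrank
  have hL : separatingFunctional D N = 𝔼 x, (testOperator D A x * B x).trace := by
    simp_rw [separatingFunctional, trace_testOperator_mul, hNAB]
    rw [Finset.expect_comm]
  have hνB : entryAverage N ≤ 𝔼 x, (B x).trace := by
    rw [entryAverage, Finset.expect_comm]
    refine Finset.expect_le_expect fun x _ => ?_
    have h3 := hAE.trace_mul_nonneg (hB x)
    rw [Matrix.sub_mul, Matrix.trace_sub, Matrix.one_mul, Matrix.smul_mul, Matrix.trace_smul,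
      Matrix.sum_mul, Matrix.trace_sum, smul_eq_mul, ← div_eq_inv_mul,
      ← Fintype.expect_eq_sum_div_card, sub_nonneg] at h3
    simpa only [hNAB] using h3
  rw [hL]
  exact neg_le_expect_trace_testOperator_mul (by omega) (by omega) hD hA hAa hAE hB hBtr hν hνB hε
    hε1 hk h1 h2
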